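/- Let $\mathcal K$ be a locally presentable category and let $\mathcal K^{\to}$ be its category of arrows; classes of morphisms of $\mathcal K$ are regarded as full subcategories of $\mathcal K^{\to}$. A functor $F\colon\mathcal M\to\mathcal C$ is \emph{accessible} if $\mathcal M$ and $\mathcal C$ are accessible categories and $F$ preserves $\lambda$-directed colimits for some regular cardinal $\lambda$. The \emph{full image} of $F$ is the full subcategory of $\mathcal C$ consisting of the objects isomorphic to some $FM$ with $M\in\mathcal M$. For a class $\mathcal X$ of morphisms of $\mathcal K$, let $\overline{\mathcal X}$ be its \emph{2-out-of-3 closure}, i.e. the smallest class of morphisms that contains $\mathcal X$ and satisfies: (1) if $f,g\in\overline{\mathcal X}$ then $gf\in\overline{\mathcal X}$; (2) if $gf,f\in\overline{\mathcal X}$ then $g\in\overline{\mathcal X}$; (3) if $gf,g\in\overline{\mathcal X}$ then $f\in\overline{\mathcal X}$ (for composable $f,g$). Let $\mathcal X\subseteq\mathcal K^{\to}$ be a full image of an accessible functor. Then $\overline{\mathcal X}$ is a full image of an accessible functor. Moreover, define $\mathcal X_0=\mathcal X$ and $\mathcal X_{n+1}=\mathcal X_n\cup\mathcal Y_n$. Here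 $\mathcal Y_n$ is the full image (closed under isomorphism) in $\mathcal K^{\to}$ of a pseudopullback over $\mathcal K^{\to}\times\mathcal K^{\to}$ of the inclusion $\mathcal X_n\times\mathcal X_n\to\mathcal K^{\to}\times\mathcal K^{\to}$ and a functor from the category of composable pairs $A\xrightarrow{f}B\xrightarrow{g}C$ in $\mathcal K$, namely: \begin{itemize} \item if $n\equiv 0 \pmod 3$, the pseudopullback along $(f,g)\mapsto(f,g)$, mapped to $\mathcal K^{\to}$ by $(f,g)\mapsto gf$ (so $\mathcal Y_n$ consists of the composites $gf$ with $f,g\in\mathcal X_n$); \item if $n\equiv 1 \pmod 3$, the pseudopullback along $(f,g)\mapsto(f,gf)$, mapped by $(f,g)\mapsto g$ (so $\mathcal Y_n$ consists of those $g$ such that $f,gf\in\mathcal X_n$ for some $f$); \item if $n\equiv 2 \pmod 3$, the pseudopullback along $(f,g)\mapsto(g,gf)$, mapped by $(f,g)\mapsto f$ (so $\mathcal Y_n$ consists of those $f$ such that $g,gf\in\mathcal X_n$ for some $g$). \end{itemize} Then every $\mathcal X_n$ is a full image of an accessible functor, and $\overline{\mathcal X}=\bigcup_{n<\omega}\mathcal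 X_n$. -/

import Mathlib

open CategoryTheory CategoryTheory.Limits

universe w v u

namespace FullImage

section Accessible

/-- `P` is a full image of an accessible functor `F : M ⥤ C`: both `M` and `C` are accessible, `F`
preserves `κ`-filtered colimits for some regular cardinal `κ`, and `P` is the (replete) full
subcategory of `C` on the objects isomorphic to some `F.obj m`.
Here `w` is the universe of sets, so that `M` is a locally small category with a class of objects;
every category that is accessible relative to `w` is equivalent to one of this size. -/
def IsFullImageOfAccessible {C : Type u} [Category.{v} C] (P : ObjectProperty C) : Prop :=
  IsAccessibleCategory.{w} C ∧
    ∃ (M : Type (w + 1)) (_ : Category.{w} M) (F : M ⥤ C),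
      IsAccessibleCategory.{w} M ∧ F.IsAccessible.{w} ∧ F.essImage = P

end Accessible

section Classes

variable {K : Type u} [Category.{v} K]

/-- A class of morphisms of `K`, regarded as a full subcategory of the category of arrows. -/
def arrows (X : MorphismProperty K) : ObjectProperty (Arrow K) := fun f => X f.hom

/-- The 2-out-of-3 closure: the smallest class of morphisms that contains `X` and has the
2-out-of-3 property (closed under composition and under cancellation on either side). -/
def twoOutOfThreeClosure (X : MorphismProperty K) : MorphismProperty K :=
  sInf {W | X ≤ W ∧ W.HasTwoOutOfThreeProperty}

lemma twoOutOfThreeClosure_iff (X : MorphismProperty K) {A B : K} (f : A ⟶ B) :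
    twoOutOfThreeClosure X f ↔
      ∀ W : MorphismProperty K, X ≤ W → W.HasTwoOutOfThreeProperty → W f := by
  simp only [twoOutOfThreeClosure, MorphismProperty.sInf_iff]
  exact ⟨fun h W h₁ h₂ => h W ⟨h₁, h₂⟩, fun h W hW => h W hW.1 hW.2⟩

lemma le_twoOutOfThreeClosure (X : MorphismProperty K) : X ≤ twoOutOfThreeClosure X :=
  fun _ _ f hf => (twoOutOfThreeClosure_iff X f).2 fun _ h _ => h f hf

lemma twoOutOfThreeClosure_le {X W : MorphismProperty K} (h : X ≤ W)
    (hW : W.HasTwoOutOfThreeProperty) : twoOutOfThreeClosure X ≤ W :=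
  fun _ _ f hf => (twoOutOfThreeClosure_iff X f).1 hf W h hW

lemma hasTwoOutOfThreeProperty_twoOutOfThreeClosure (X : MorphismProperty K) :
    (twoOutOfThreeClosure X).HasTwoOutOfThreeProperty where
  comp_mem f g hf hg := by
    rw [twoOutOfThreeClosure_iff] at hf hg ⊢
    exact fun W h hW => W.comp_mem f g (hf W h hW) (hg W h hW)
  of_postcomp f g hg hfg := by
    rw [twoOutOfThreeClosure_iff] at hg hfg ⊢
    exact fun W h hW => W.of_postcomp f g (hg W h hW) (hfg W h hW)
  of_precomp f g hf hfg := by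
    rw [twoOutOfThreeClosure_iff] at hf hfg ⊢
    exact fun W h hW => W.of_precomp f g (hf W h hW) (hfg W h hW)

end Classes

section Stages

variable (K : Type u) [Category.{v} K]

/-- The functor that sends a composable pair `X₀ ⟶ X₁ ⟶ X₂` to the arrow `Xᵢ ⟶ Xⱼ`. -/
@[simps]
def edge (i j : Fin 3) (h : i ≤ j) : ComposableArrows K 2 ⥤ Arrow K where
  obj X := Arrow.mk (X.map (homOfLE h))
  map φ := Arrow.homMk (φ.app i) (φ.app j) (φ.naturality (homOfLE h)).symm

/-- The first arrow `f` of a composable pair `(f, g)`. -/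
abbrev first : ComposableArrows K 2 ⥤ Arrow K := edge K 0 1 (by decide)

/-- The second arrow `g` of a composable pair `(f, g)`. -/
abbrev second : ComposableArrows K 2 ⥤ Arrow K := edge K 1 2 (by decide)

/-- The composite `g ∘ f` of a composable pair `(f, g)`. -/
abbrev composite : ComposableArrows K 2 ⥤ Arrow K := edge K 0 2 (by decide)

variable {K}

/-- The pseudopullback of the full subcategory `X × X` of `K^→ × K^→` along
`(p, q) : K^{→→} ⥤ K^→ × K^→`: the composable pairs whose `p` and `q` are in `X`
(up to a chosen isomorphism). -/
abbrev PairsPullback (X : MorphismProperty K) (p q : ComposableArrows K 2 ⥤ Arrow K) :=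
  CategoricalPullback ((arrows X).ι.prod (arrows X).ι) (p.prod' q)

/-- The full image in `K^→` of this pseudopullback under `r : K^{→→} ⥤ K^→`. -/
def pairsImage (X : MorphismProperty K) (p q r : ComposableArrows K 2 ⥤ Arrow K) :
    MorphismProperty K := fun _ _ f =>
  (CategoricalPullback.π₂ ((arrows X).ι.prod (arrows X).ι) (p.prod' q) ⋙ r).essImage (Arrow.mk f)

/-- Composites `g ∘ f` with `f` and `g` in `X`. -/
def composites (X : MorphismProperty K) : MorphismProperty K :=
  pairsImage X (first K) (second K) (composite K)

/-- Those `g` for which `f` and `g ∘ f` are in `X` for some `f`. -/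
def leftFactors (X : MorphismProperty K) : MorphismProperty K :=
  pairsImage X (first K) (composite K) (second K)

/-- Those `f` for which `g` and `g ∘ f` are in `X` for some `g`. -/
def rightFactors (X : MorphismProperty K) : MorphismProperty K :=
  pairsImage X (second K) (composite K) (first K)

/-- The stages `X₀ ⊆ X₁ ⊆ …`: starting with `X`, one adjoins cyclically the composites, the left
factors and the right factors. -/
def stage (X : MorphismProperty K) : ℕ → MorphismProperty K
  | 0 => X
  | n + 1 => stage X n ⊔
      (if n % 3 = 0 then composites (stage X n)
      else if n % 3 = 1 then leftFactors (stage X n)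
      else rightFactors (stage X n))

end Stages

end FullImage

/-!
Why the 2-out-of-3 closure of a full image of an accessible functor is again such a full image.

Each stage adds to `stage X n` the full image of a functor on a pseudopullback. The essential point
is therefore the limit theorem for accessible categories, in the case of pseudopullbacks:
`isAccessibleCategory_categoricalPullback` shows that the pseudopullback of accessible functors
`F : A ⥤ B` and `G : C ⥤ B` is accessible, with accessible projections.

For its proof, choose `κ` such that `A`, `C`, `F` and `G` are `κ`-accessible and `F`, `G` preserve
`κ`-presentable objects (`exists_isCardinalPresentable_obj`), and `l` of the form `(2 ^ ν)⁺` with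
`κ ≤ ν`. An object `(a, c, F a ≅ G c)` is presented by two diagrams of `κ`-presentable objects with
colimits `a` and `c`, indexed by the same `κ`-directed `K`. The isomorphism and its inverse are
given by morphisms between the terms of the diagrams (`LevelwiseHom`), together with functions on
`K` that choose the stages at which the necessary equations hold. By the arithmetic of `l`, the
subsets of `K` that are `κ`-directed, of cardinality `< l` and closed under these functions form an
`l`-directed covering of `K` (`exists_isGoodSubset`). Over each of them the colimits of the
restricted diagrams, with the restricted isomorphism, are an object of the pseudopullback with
`l`-presentable components, and the given object is the `l`-directed colimit of these. With no
function to be closed under, the same argument raises the index of accessibility of a category from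
`κ` to `l` (`isCardinalAccessibleCategory_of_powLT`).

Products of categories and the category of composable pairs are themselves pseudopullbacks, so that
they are accessible. A union of a set of full images is the full image of the induced functor on the
disjoint union of the sources (`isAccessible_sigmaDesc`); this gives the step from `stage X n` to
`stage X (n + 1)` and the union of all stages. Finally, the union of the stages has the 2-out-of-3
property, because any two of its members lie in a common stage whose index has any prescribed
residue modulo 3 (`twoOutOfThreeClosure_eq_iSup_stage`).
-/

universe v' v₁ v₂ v₃ u' u₁ u₂ u₃

namespace FullImage

/-! ### Small directed subsets closed under operations -/

section GoodSubsets

open Cardinal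

/-- A subset of cardinality `≤ μ` generates, under at most `μ` operations of arities `β i` with
`μ ^ β i ≤ μ`, a subset of cardinality `≤ μ`: its elements are the values of terms, which form a
`W`-type. -/
theorem exists_subset_closed_under_operations {K ι : Type w} (β : ι → Type w)
    (op : ∀ i, (β i → K) → K) (A : Set K) {μ : Cardinal.{w}} (hμ : ℵ₀ ≤ μ) (hι : #ι ≤ μ)
    (hβ : ∀ i, μ ^ #(β i) ≤ μ) (hA : #A ≤ μ) :
    ∃ S : Set K, A ⊆ S ∧ #S ≤ μ ∧ ∀ i (x : β i → K), (∀ b, x b ∈ S) → op i x ∈ S := by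
  let γ : A ⊕ ι → Type w := Sum.elim (fun _ ↦ PEmpty) β
  let ev : WType γ → K := WType.elim K fun
    | ⟨.inl a, _⟩ => a.1
    | ⟨.inr i, x⟩ => op i x
  have hW : #(WType γ) ≤ μ := by
    refine WType.cardinalMk_le_of_le' ?_
    have hle : ∀ a, μ ^ Cardinal.lift.{w} #(γ a) ≤ μ := by
      rintro (a | i)
      · simpa [γ] using one_le_aleph0.trans hμ
      · simpa [γ] using hβ i
    calc (Cardinal.sum fun a ↦ μ ^ Cardinal.lift.{w} #(γ a)) ≤ Cardinal.sum fun _ : A ⊕ ι ↦ μ :=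
          Cardinal.sum_le_sum _ _ hle
      _ = (#A + #ι) * μ := by simp
      _ ≤ (μ + μ) * μ := by gcongr
      _ = μ := by rw [add_eq_self hμ, mul_eq_self hμ]
  refine ⟨Set.range ev, fun a ha ↦ ⟨.mk (.inl ⟨a, ha⟩) PEmpty.elim, rfl⟩,
    mk_range_le.trans hW, fun i x hx ↦ ?_⟩
  choose y hy using hx
  exact ⟨.mk (.inr i) y, congrArg (op i) (funext hy)⟩

/-- `l` is the successor of a power `2 ^ ν` with `κ ≤ ν`. For regular `κ` this implies that `κ` is
sharply smaller than `l`; cardinals `l` of this form are the only ones to which the index of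
accessibility is raised. -/
def PowLT (κ l : Cardinal.{w}) : Prop := ∃ ν, κ ≤ ν ∧ l = Order.succ (2 ^ ν)

lemma PowLT.lt {κ l : Cardinal.{w}} (h : PowLT κ l) : κ < l := by
  obtain ⟨ν, h, rfl⟩ := h
  exact h.trans_lt ((cantor ν).trans (Order.lt_succ _))

/-- Arbitrarily many conditions `PowLT (κ i) l` can be satisfied at once by a regular `l`. -/
lemma exists_powLT {ι : Type w} (κ : ι → Cardinal.{w}) :
    ∃ l : Cardinal.{w}, l.IsRegular ∧ ∀ i, PowLT (κ i) l := by
  let ν := max ℵ₀ (Cardinal.sum κ)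
  exact ⟨Order.succ (2 ^ ν), isRegular_succ ((le_max_left _ _).trans (cantor ν).le),
    fun i ↦ ⟨ν, (Cardinal.le_sum κ i).trans (le_max_right _ _), rfl⟩⟩

variable {K ι : Type w} [PartialOrder K] (κ l : Cardinal.{w}) [Fact κ.IsRegular]

/-- A subset of `K` that is `κ`-directed, of cardinality `< l`, and closed under the binary
operations `op i`. Unary operations are included as binary ones that ignore their second
argument. -/
structure IsGoodSubset (op : ι → K → K → K) (S : Set K) : Prop where
  isCardinalFiltered : IsCardinalFiltered S κ
  hasCardinalLT : HasCardinalLT S l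
  op_mem (i : ι) {x y : K} (hx : x ∈ S) (hy : y ∈ S) : op i x y ∈ S

variable {κ l}

/-- For `l = (2 ^ ν)⁺`, every subset of cardinality `< l` lies in a good one. It is closed under the
operations `op i` and under chosen upper bounds of the families indexed by subsets of `κ` of
cardinality `< κ`. There are at most `2 ^ ν` such operations, and `(2 ^ ν) ^ ν = 2 ^ ν`. -/
theorem exists_isGoodSubset [IsCardinalFiltered K κ] (h : PowLT κ l) (op : ι → K → K → K)
    (hι : #ι ≤ ℵ₀) (A : Set K) (hA : HasCardinalLT A l) :
    ∃ S : Set K, A ⊆ S ∧ IsGoodSubset κ l op S := by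
  obtain ⟨ν, hν, rfl⟩ := h
  have hκ : κ.IsRegular := Fact.out
  have hκ₀ : ℵ₀ ≤ κ := hκ.aleph0_le
  have hν₀ : ℵ₀ ≤ ν := hκ₀.trans hν
  have hμ : ℵ₀ ≤ (2 : Cardinal.{w}) ^ ν := hν₀.trans (cantor ν).le
  let T := { B : Set κ.ord.ToType // HasCardinalLT B κ }
  let β : T ⊕ ι → Type w := Sum.elim (fun B ↦ B.1) (fun _ ↦ ULift.{w} Bool)
  obtain ⟨S, hAS, hS, hop⟩ := exists_subset_closed_under_operations β
    (fun
      | .inl B => fun x ↦ IsCardinalFiltered.max x B.2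
      | .inr i => fun x ↦ op i (x ⟨false⟩) (x ⟨true⟩)) A hμ (by
      have h₁ : #T ≤ 2 ^ ν := (mk_subtype_le _).trans (by
        rw [mk_set, mk_ord_toType]
        exact power_le_power_left two_ne_zero hν)
      rw [mk_sum, Cardinal.lift_id, Cardinal.lift_id]
      exact add_le_of_le hμ h₁ (hι.trans hμ)) (fun i ↦ by
      rw [← power_mul]
      refine power_le_power_left two_ne_zero ?_
      refine (mul_le_mul_right ?_ ν).trans (mul_eq_self hν₀).le
      rcases i with B | i
      · exact ((hasCardinalLT_iff_cardinal_mk_lt _ _).1 B.2).le.trans hν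
      · exact (lt_aleph0_of_finite (ULift.{w} Bool)).le.trans hν₀)
      (by rwa [hasCardinalLT_iff_cardinal_mk_lt, Order.lt_succ_iff] at hA)
  refine ⟨S, hAS, isCardinalFiltered_preorder _ _ fun X x hX ↦ ?_,
    (hasCardinalLT_iff_cardinal_mk_lt _ _).2 (Order.lt_succ_iff.2 hS), fun i x y hx hy ↦
      hop (.inr i) (fun b ↦ if b.down then y else x) (by rintro ⟨_ | _⟩ <;> simpa)⟩
  obtain ⟨e⟩ : Nonempty (X ↪ κ.ord.ToType) := by
    rw [← Cardinal.le_def, mk_ord_toType]; exact hX.le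
  let B : T := ⟨Set.range e, by
    rwa [hasCardinalLT_iff_cardinal_mk_lt, mk_range_eq _ e.injective]⟩
  let r : X ≃ B.1 := Equiv.ofInjective e e.injective
  have hB := hop (.inl B) (fun b ↦ (x (r.symm b)).1) (fun b ↦ (x _).2)
  exact ⟨⟨_, hB⟩, fun k ↦ by
    have := leOfHom (IsCardinalFiltered.toMax (fun b ↦ (x (r.symm b)).1) B.2 (r k))
    rw [Equiv.symm_apply_apply] at this
    exact this⟩

/-- The union of fewer than `l` good subsets has cardinality `< l`, hence lies in a good subset. -/
instance isCardinalFiltered_goodSubsets [IsCardinalFiltered K κ] [Fact l.IsRegular]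
    [h : Fact (PowLT κ l)] [Countable ι] (op : ι → K → K → K) :
    IsCardinalFiltered (Subtype (IsGoodSubset κ l op)) l :=
  isCardinalFiltered_preorder _ _ fun X S hX ↦ by
    obtain ⟨T, hT, hT'⟩ := exists_isGoodSubset h.out op (mk_le_aleph0) (⋃ x, (S x).1)
      (hasCardinalLT_iUnion _ ((hasCardinalLT_iff_cardinal_mk_lt _ _).2 hX)
        fun x ↦ (S x).2.hasCardinalLT)
    exact ⟨⟨T, hT'⟩, fun x ↦ (Set.subset_iUnion (fun x ↦ (S x).1) x).trans hT⟩

lemma exists_mem_isGoodSubset [IsCardinalFiltered K κ] [hl : Fact l.IsRegular]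
    [h : Fact (PowLT κ l)] [Countable ι] (op : ι → K → K → K) (k : K) :
    ∃ S : Subtype (IsGoodSubset κ l op), k ∈ S.1 := by
  obtain ⟨T, hT, hT'⟩ := exists_isGoodSubset h.out op (mk_le_aleph0) {k}
    (hasCardinalLT_of_finite _ _ hl.out.aleph0_le)
  exact ⟨⟨T, hT'⟩, hT rfl⟩

end GoodSubsets

/-! ### Colimits over subsets of the index, and raising the index of accessibility -/

section PartialColimits

lemma mem_of_hom {K : Type w} {p : Set K → Prop} {S T : Subtype p} (f : S ⟶ T) {k : K}
    (hk : k ∈ S.1) : k ∈ T.1 :=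
  leOfHom f hk

variable {K : Type w} [PartialOrder K] {A : Type u} [Category.{v} A]

/-- The inclusion of a subset of a partially ordered type, as a functor. -/
abbrev subsetInclusion (S : Set K) : S ⥤ K := (Subtype.mono_coe (· ∈ S)).functor

lemma hasCardinalLT_arrow_of_partialOrder {l : Cardinal.{w}} (hl : Cardinal.aleph0 ≤ l)
    (hK : HasCardinalLT K l) : HasCardinalLT (Arrow K) l :=
  (hasCardinalLT_prod hl hK hK).of_injective (fun f ↦ (f.left, f.right)) (by
    rintro ⟨a, b, f⟩ ⟨a', b', f'⟩ h
    obtain ⟨rfl, rfl⟩ := Prod.ext_iff.1 h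
    obtain rfl : f = f' := Subsingleton.elim _ _
    rfl)

variable {p : Set K → Prop} {D : K ⥤ A}

/-- The cocone on the restriction of `D` to a subset `S` that is given by its legs. -/
@[simps]
def restrictedCocone {S : Set K} {Z : A} (ι : ∀ k ∈ S, D.obj k ⟶ Z)
    (w : ∀ {k k'} (hk : k ∈ S) (hk' : k' ∈ S) (h : k ≤ k'),
      D.map (homOfLE h) ≫ ι k' hk' = ι k hk) : Cocone (subsetInclusion S ⋙ D) where
  pt := Z
  ι.app k := ι k.1 k.2
  ι.naturality k k' g := (w k.2 k'.2 (leOfHom g)).trans (Category.comp_id _).symm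

variable (D) in
/-- A presentation of `Z` as the colimit of the restriction of `D` to a subset `S`. The legs are
indexed by elements of `K` together with a proof of membership in `S`. -/
structure PartialColimit (S : Set K) (Z : A) where
  /-- The legs of the colimit cocone. -/
  ι : ∀ k ∈ S, D.obj k ⟶ Z
  w : ∀ {k k'} (hk : k ∈ S) (hk' : k' ∈ S) (h : k ≤ k'),
    D.map (homOfLE h) ≫ ι k' hk' = ι k hk
  /-- The legs form a colimit cocone. -/
  isColimit : IsColimit (restrictedCocone ι w)

namespace PartialColimit

variable {S : Set K} {Z Z' : A}

lemma w_assoc (c : PartialColimit D S Z) {k k' : K} (hk : k ∈ S) (hk' : k' ∈ S) (h : k ≤ k')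
    (f : Z ⟶ Z') : D.map (homOfLE h) ≫ c.ι k' hk' ≫ f = c.ι k hk ≫ f := by
  rw [← Category.assoc, c.w]

lemma hom_ext (c : PartialColimit D S Z) {f g : Z ⟶ Z'}
    (h : ∀ k hk, c.ι k hk ≫ f = c.ι k hk ≫ g) : f = g :=
  c.isColimit.hom_ext fun k ↦ h k.1 k.2

/-- The morphism out of a partial colimit that is given by a compatible family. -/
def desc (c : PartialColimit D S Z) (φ : ∀ k ∈ S, D.obj k ⟶ Z')
    (w : ∀ {k k'} (hk : k ∈ S) (hk' : k' ∈ S) (h : k ≤ k'),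
      D.map (homOfLE h) ≫ φ k' hk' = φ k hk) : Z ⟶ Z' :=
  c.isColimit.desc (restrictedCocone φ w)

lemma fac (c : PartialColimit D S Z) (φ : ∀ k ∈ S, D.obj k ⟶ Z')
    (w : ∀ {k k'} (hk : k ∈ S) (hk' : k' ∈ S) (h : k ≤ k'),
      D.map (homOfLE h) ≫ φ k' hk' = φ k hk) (k : K) (hk : k ∈ S) :
    c.ι k hk ≫ c.desc φ w = φ k hk :=
  c.isColimit.fac (restrictedCocone φ w) ⟨k, hk⟩

lemma fac_assoc (c : PartialColimit D S Z) (φ : ∀ k ∈ S, D.obj k ⟶ Z')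
    (w : ∀ {k k'} (hk : k ∈ S) (hk' : k' ∈ S) (h : k ≤ k'),
      D.map (homOfLE h) ≫ φ k' hk' = φ k hk) (k : K) (hk : k ∈ S) {W : A} (f : Z' ⟶ W) :
    c.ι k hk ≫ c.desc φ w ≫ f = φ k hk ≫ f := by
  rw [← Category.assoc, c.fac]

/-- The image of a partial colimit by a functor that preserves it. -/
noncomputable def map (c : PartialColimit D S Z) {B : Type u'} [Category.{v'} B] (F : A ⥤ B)
    [PreservesColimit (subsetInclusion S ⋙ D) F] : PartialColimit (D ⋙ F) S (F.obj Z) where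
  ι k hk := F.map (c.ι k hk)
  w hk hk' h := (F.map_comp _ _).symm.trans (congrArg F.map (c.w hk hk' h))
  isColimit := (isColimitOfPreserves F c.isColimit).ofIsoColimit (Cocone.ext (Iso.refl _)
    fun _ ↦ Category.comp_id _)

variable (D S) in
/-- The chosen colimit of the restriction of `D` to `S`. -/
noncomputable def chosen [HasColimit (subsetInclusion S ⋙ D)] :
    PartialColimit D S (colimit (subsetInclusion S ⋙ D)) where
  ι k hk := colimit.ι (subsetInclusion S ⋙ D) ⟨k, hk⟩
  w {k k'} hk hk' h := colimit.w (subsetInclusion S ⋙ D)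
    (homOfLE (show (⟨k, hk⟩ : S) ≤ ⟨k', hk'⟩ from h))
  isColimit := (colimit.isColimit (subsetInclusion S ⋙ D)).ofIsoColimit (Cocone.ext (Iso.refl _)
    fun _ ↦ Category.comp_id _)

end PartialColimit

variable (p D) [∀ S : Subtype p, HasColimit (subsetInclusion S.1 ⋙ D)]

/-- For a diagram `D` indexed by `K`, the colimits of its restrictions to the subsets of `K`
satisfying `p` form a diagram indexed by these subsets. -/
noncomputable def partialColimits : Subtype p ⥤ A where
  obj S := colimit (subsetInclusion S.1 ⋙ D)
  map {S T} f := (PartialColimit.chosen D S.1).desc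
    (fun k hk ↦ (PartialColimit.chosen D T.1).ι k (mem_of_hom f hk))
    (fun _ _ h ↦ PartialColimit.w _ _ _ h)
  map_id S := PartialColimit.hom_ext (PartialColimit.chosen D S.1) fun k hk ↦ by
    rw [PartialColimit.fac, Category.comp_id]
  map_comp {S T U} f g := PartialColimit.hom_ext (PartialColimit.chosen D S.1) fun k hk ↦ by
    rw [PartialColimit.fac, PartialColimit.fac_assoc, PartialColimit.fac]

/-- The partial colimit over `S`, as an object of the diagram of partial colimits. -/
noncomputable def partialColimit (S : Subtype p) :
    PartialColimit D S.1 ((partialColimits p D).obj S) :=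
  PartialColimit.chosen D S.1

lemma partialColimit_ι_map {S T : Subtype p} (f : S ⟶ T) (k : K) (hk : k ∈ S.1) :
    (partialColimit p D S).ι k hk ≫ (partialColimits p D).map f =
      (partialColimit p D T).ι k (mem_of_hom f hk) :=
  PartialColimit.fac _ _ (fun _ _ h ↦ PartialColimit.w _ _ _ h) _ _

lemma partialColimit_ι_map_assoc {S T : Subtype p} (f : S ⟶ T) (k : K) (hk : k ∈ S.1) {W : A}
    (g : (partialColimits p D).obj T ⟶ W) :
    (partialColimit p D S).ι k hk ≫ (partialColimits p D).map f ≫ g =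
      (partialColimit p D T).ι k (mem_of_hom f hk) ≫ g := by
  rw [← Category.assoc, partialColimit_ι_map]

variable {D} in
/-- The cocone on the partial colimits that is induced by a cocone on the whole diagram. -/
@[simps pt]
noncomputable def partialColimitsCocone (c : Cocone D) : Cocone (partialColimits p D) where
  pt := c.pt
  ι.app S := (partialColimit p D S).desc (fun k _ ↦ c.ι.app k) (fun _ _ h ↦ c.w (homOfLE h))
  ι.naturality S T f := (partialColimit p D S).hom_ext fun k hk ↦ by
    rw [partialColimit_ι_map_assoc, PartialColimit.fac, PartialColimit.fac_assoc]
    exact (Category.comp_id _).symm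

variable {D} in
lemma partialColimit_ι_cocone (c : Cocone D) (S : Subtype p) (k : K) (hk : k ∈ S.1) :
    (partialColimit p D S).ι k hk ≫ (partialColimitsCocone p c).ι.app S = c.ι.app k :=
  PartialColimit.fac _ _ (fun _ _ h ↦ c.w (homOfLE h)) _ _

variable {D} in
lemma partialColimit_ι_cocone_assoc (c : Cocone D) (S : Subtype p) (k : K) (hk : k ∈ S.1) {W : A}
    (f : c.pt ⟶ W) :
    (partialColimit p D S).ι k hk ≫ (partialColimitsCocone p c).ι.app S ≫ f = c.ι.app k ≫ f :=
  (Category.assoc _ _ _).symm.trans (congrArg (· ≫ f) (partialColimit_ι_cocone p c S k hk))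

variable {p D} in
/-- If `p` singles out a directed family of subsets that covers `K`, then the colimit of `D` is
the colimit of the partial colimits. -/
noncomputable def isColimitPartialColimitsCocone [IsDirectedOrder (Subtype p)]
    (hp : ∀ k : K, ∃ S : Subtype p, k ∈ S.1) {c : Cocone D} (hc : IsColimit c) :
    IsColimit (partialColimitsCocone p c) := by
  choose S hS using hp
  -- The leg at `k` of a cocone on the partial colimits does not depend on the subset that
  -- contains `k`.
  have key (s : Cocone (partialColimits p D)) (k : K) (T T' : Subtype p) (hT : k ∈ T.1)
      (hT' : k ∈ T'.1) : (partialColimit p D T).ι k hT ≫ s.ι.app T =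
        (partialColimit p D T').ι k hT' ≫ s.ι.app T' := by
    obtain ⟨U, h, h'⟩ := exists_ge_ge T T'
    rw [← s.w (homOfLE h), ← s.w (homOfLE h'), partialColimit_ι_map_assoc,
      partialColimit_ι_map_assoc]
  let d (s : Cocone (partialColimits p D)) : Cocone D :=
    { pt := s.pt
      ι.app k := (partialColimit p D (S k)).ι k (hS k) ≫ s.ι.app (S k)
      ι.naturality k k' g := by
        obtain ⟨U, h, h'⟩ := exists_ge_ge (S k) (S k')
        have hk := mem_of_hom (homOfLE h) (hS k)
        have hk' := mem_of_hom (homOfLE h') (hS k')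
        rw [key s k _ U _ hk, key s k' _ U _ hk']
        exact ((partialColimit p D U).w_assoc hk hk' (leOfHom g) _).trans
          (Category.comp_id _).symm }
  exact
    { desc s := hc.desc (d s)
      fac s T := (partialColimit p D T).hom_ext fun k hk ↦
        (partialColimit_ι_cocone_assoc p c T k hk (hc.desc (d s))).trans
          ((hc.fac (d s) k).trans (key s k _ _ _ _))
      uniq s m hm := hc.hom_ext fun k ↦
        (partialColimit_ι_cocone_assoc p c (S k) k (hS k) m).symm.trans
          ((congrArg (_ ≫ ·) (hm (S k))).trans (hc.fac (d s) k).symm) }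

end PartialColimits

section Presentable

variable {A : Type u} [Category.{v} A]

/-- An object is `κ`-presentable if morphisms from it to a `κ`-filtered colimit factor through the
diagram, essentially uniquely. -/
lemma isCardinalPresentable_of_exists {X : A} {κ : Cardinal.{w}} [Fact κ.IsRegular]
    (h₁ : ∀ (J : Type w) [SmallCategory J] [IsCardinalFiltered J κ] {Z : J ⥤ A} (c : Cocone Z)
      (_ : IsColimit c) (f : X ⟶ c.pt), ∃ (j : J) (g : X ⟶ Z.obj j), g ≫ c.ι.app j = f)
    (h₂ : ∀ (J : Type w) [SmallCategory J] [IsCardinalFiltered J κ] {Z : J ⥤ A} (c : Cocone Z)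
      (_ : IsColimit c) (j : J) (f g : X ⟶ Z.obj j), f ≫ c.ι.app j = g ≫ c.ι.app j →
        ∃ (k : J) (a : j ⟶ k), f ≫ Z.map a = g ≫ Z.map a) :
    IsCardinalPresentable X κ where
  preservesColimitOfShape J _ _ := ⟨fun {F} ↦ ⟨fun {c} hc ↦ ⟨by
    have := isFiltered_of_isCardinalFiltered J κ
    refine Types.FilteredColimit.isColimitOf' _ _ (fun f ↦ ?_) (fun j f g h ↦ ?_)
    · obtain ⟨j, g, h⟩ := h₁ J c hc f
      exact ⟨j, g, h.symm⟩
    · exact h₂ J c hc j f g h⟩⟩⟩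

end Presentable

section Raising

variable {A : Type u} [Category.{v} A] (κ l : Cardinal.{w}) [Fact κ.IsRegular]

variable (A) in
/-- The objects that are colimits of `κ`-directed diagrams of `κ`-presentable objects indexed by
partially ordered types of cardinality `< l`. -/
def smallDirectedColimits : ObjectProperty A := fun X ↦
  ∃ (T : Type w) (_ : PartialOrder T), IsCardinalFiltered T κ ∧ HasCardinalLT T l ∧
    (isCardinalPresentable A κ).colimitsOfShape T X

variable {κ l}

lemma exists_directed_presentation [IsCardinalAccessibleCategory A κ] (X : A) :
    ∃ (T : Type w) (_ : PartialOrder T) (_ : IsCardinalFiltered T κ),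
      Nonempty ((isCardinalPresentable A κ).ColimitOfShape T X) := by
  obtain ⟨J, _, _, ⟨p⟩⟩ :=
    (isCardinalFilteredGenerator_isCardinalPresentable A κ).exists_colimitsOfShape X
  obtain ⟨T, _, _, F, _⟩ := IsCardinalFiltered.exists_cardinal_directed J κ
  exact ⟨T, inferInstance, inferInstance, ⟨p.reindex F⟩⟩

lemma hasColimit_goodSubset [HasCardinalFilteredColimits A κ] {K ι : Type w} [PartialOrder K]
    {op : ι → K → K → K} (D : K ⥤ A) (S : Subtype (IsGoodSubset κ l op)) :
    HasColimit (subsetInclusion S.1 ⋙ D) :=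
  have := S.2.isCardinalFiltered
  have := HasCardinalFilteredColimits.hasColimitsOfShape A κ S.1
  inferInstance

lemma isDirectedOrder_goodSubsets {K ι : Type w} [PartialOrder K] [IsCardinalFiltered K κ]
    [Fact l.IsRegular] [h : Fact (PowLT κ l)] [Countable ι] (op : ι → K → K → K) :
    IsDirectedOrder (Subtype (IsGoodSubset κ l op)) :=
  have := isFiltered_of_isCardinalFiltered (Subtype (IsGoodSubset κ l op)) l
  ⟨fun S T ↦ ⟨IsFiltered.max S T, leOfHom (IsFiltered.leftToMax S T),
    leOfHom (IsFiltered.rightToMax S T)⟩⟩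

/-- Every object is an `l`-directed colimit of objects in `smallDirectedColimits A κ l`: write it as
a colimit over a `κ`-directed `K` and take the partial colimits over the good subsets of `K`. -/
lemma isCardinalFilteredGenerator_smallDirectedColimits [IsCardinalAccessibleCategory A κ]
    [Fact l.IsRegular] [h : Fact (PowLT κ l)] :
    (smallDirectedColimits A κ l).IsCardinalFilteredGenerator l where
  le_isCardinalPresentable := by
    rintro X ⟨T, _, _, hT, ⟨p⟩⟩
    exact p.isCardinalPresentable le_rfl l h.out.lt.le
      (hasCardinalLT_arrow_of_partialOrder (Cardinal.IsRegular.aleph0_le Fact.out) hT)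
  exists_colimitsOfShape X := by
    obtain ⟨K, _, _, ⟨p⟩⟩ := exists_directed_presentation (κ := κ) X
    let op : PEmpty.{w + 1} → K → K → K := PEmpty.elim
    have := hasColimit_goodSubset (κ := κ) (l := l) (op := op) p.diag
    have := isDirectedOrder_goodSubsets (κ := κ) (l := l) op
    refine ⟨Subtype (IsGoodSubset κ l op), inferInstance, inferInstance,
      ⟨{ diag := _
         ι := _
         isColimit := isColimitPartialColimitsCocone (exists_mem_isGoodSubset op) p.isColimit
         prop_diag_obj S := ?_ }⟩⟩
    exact ⟨S.1, inferInstance, S.2.isCardinalFiltered, S.2.hasCardinalLT,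
      ⟨.colimit _ fun k ↦ p.prop_diag_obj k.1⟩⟩

/-- Raising the index of accessibility. -/
lemma isCardinalAccessibleCategory_of_powLT [IsCardinalAccessibleCategory A κ] [Fact l.IsRegular]
    (h : PowLT κ l) : IsCardinalAccessibleCategory A l := by
  have : Fact (PowLT κ l) := ⟨h⟩
  have hP := isCardinalFilteredGenerator_smallDirectedColimits (A := A) (κ := κ) (l := l)
  have hl : l.IsRegular := Fact.out
  have : ObjectProperty.EssentiallySmall.{w} (smallDirectedColimits A κ l) := by
    refine .of_le (Q := (isCardinalPresentable A κ).colimitsCardinalClosure l) ?_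
    rintro X ⟨T, _, _, hT, hX⟩
    have := (isCardinalPresentable A κ).isClosedUnderColimitsOfShape_colimitsCardinalClosure l T
      (hasCardinalLT_arrow_of_partialOrder hl.aleph0_le hT)
    exact ObjectProperty.IsClosedUnderColimitsOfShape.colimitsOfShape_le _ _ _
      (ObjectProperty.colimitsOfShape_monotone T
        ((isCardinalPresentable A κ).le_colimitsCardinalClosure l) _ hX)
  have := hP.hasCardinalFilteredGenerator
  have : HasCardinalFilteredColimits A l := ⟨fun J _ _ ↦
    have := IsCardinalFiltered.of_le J h.lt.le
    HasCardinalFilteredColimits.hasColimitsOfShape A κ J⟩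
  constructor

end Raising

/-! ### Preservation of presentable objects -/

section Uniformization

open Cardinal

lemma PowLT.of_le {κ κ' l : Cardinal.{w}} (h : PowLT κ' l) (hκ : κ ≤ κ') : PowLT κ l := by
  obtain ⟨ν, h, rfl⟩ := h
  exact ⟨ν, hκ.trans h, rfl⟩

variable {A : Type u} [Category.{v} A] {B : Type u'} [Category.{v'} B]

/-- If `F` sends `κ`-presentable objects to `l`-presentable ones, it preserves `l`-presentable
objects, since these are retracts of colimits, of size `< l`, of `κ`-presentable ones. -/
lemma isCardinalPresentable_obj_of_powLT {κ l : Cardinal.{w}} [Fact κ.IsRegular]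
    [Fact l.IsRegular] (h : PowLT κ l) [IsCardinalAccessibleCategory A κ] [LocallySmall.{w} B]
    (F : A ⥤ B) [F.IsCardinalAccessible κ]
    (hF : ∀ X : A, IsCardinalPresentable X κ → IsCardinalPresentable (F.obj X) l)
    (X : A) [hX : IsCardinalPresentable X l] : IsCardinalPresentable (F.obj X) l := by
  have : Fact (PowLT κ l) := ⟨h⟩
  have : HasCardinalFilteredGenerator A κ := inferInstance
  rw [← isCardinalPresentable_iff,
    (isCardinalFilteredGenerator_smallDirectedColimits (A := A) (κ := κ)
      (l := l)).isPresentable_eq_retractClosure] at hX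
  obtain ⟨Y, ⟨T, _, _, hT, ⟨p⟩⟩, ⟨r⟩⟩ := hX
  have := F.preservesColimitsOfShape_of_isCardinalAccessible κ T
  have (k : T) : IsCardinalPresentable ((p.diag ⋙ F).obj k) l := hF _ (p.prop_diag_obj k)
  have : IsCardinalPresentable (F.obj Y) l :=
    isCardinalPresentable_of_isColimit _ (isColimitOfPreserves F p.isColimit) l
      (hasCardinalLT_arrow_of_partialOrder (Cardinal.IsRegular.aleph0_le Fact.out) hT)
  exact (r.map F).isCardinalPresentable l

variable (A) in
lemma exists_isCardinalAccessibleCategory [IsAccessibleCategory.{w} A] :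
    ∃ ν : Cardinal.{w}, ∀ (l : Cardinal.{w}) [Fact l.IsRegular], PowLT ν l →
      IsCardinalAccessibleCategory A l := by
  obtain ⟨κ, _, _⟩ := IsAccessibleCategory.exists_cardinal A
  exact ⟨κ, fun l _ h ↦ isCardinalAccessibleCategory_of_powLT h⟩

lemma exists_isCardinalAccessible (F : A ⥤ B) [F.IsAccessible.{w}] :
    ∃ ν : Cardinal.{w}, ∀ (l : Cardinal.{w}) [Fact l.IsRegular], PowLT ν l →
      F.IsCardinalAccessible l := by
  obtain ⟨κ, _, _⟩ := Functor.IsAccessible.exists_cardinal.{w} (F := F)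
  exact ⟨κ, fun l _ h ↦ F.isCardinalAccessible_of_le h.lt.le⟩

/-- The uniformization theorem for a single functor: `F` preserves `l`-presentable objects as soon
as `l` is large enough for the images of a set of representatives of the `κ`-presentable objects. -/
lemma exists_isCardinalPresentable_obj [IsAccessibleCategory.{w} A] [IsAccessibleCategory.{w} B]
    (F : A ⥤ B) [F.IsAccessible.{w}] :
    ∃ ν : Cardinal.{w}, ∀ (l : Cardinal.{w}) [Fact l.IsRegular], PowLT ν l →
      ∀ (X : A) [IsCardinalPresentable X l], IsCardinalPresentable (F.obj X) l := by
  obtain ⟨ν₁, h₁⟩ := exists_isCardinalAccessibleCategory A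
  obtain ⟨ν₂, h₂⟩ := exists_isCardinalAccessible F
  obtain ⟨κ, hκ, h⟩ := exists_powLT (fun b : ULift.{w} Bool ↦ cond b.down ν₁ ν₂)
  have : Fact κ.IsRegular := ⟨hκ⟩
  have := h₁ κ (h ⟨true⟩)
  have := h₂ κ (h ⟨false⟩)
  have : LocallySmall.{w} B := by
    obtain ⟨κ, _, _⟩ := IsAccessibleCategory.exists_cardinal B
    infer_instance
  obtain ⟨Q, _, hQ, hQ'⟩ :=
    ObjectProperty.EssentiallySmall.exists_small_le.{w} (isCardinalPresentable A κ)
  choose c hc hc' using fun X : B ↦ Functor.IsAccessible.exists_cardinal.{w}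
    (F := coyoneda.obj (Opposite.op X))
  refine ⟨max κ (Cardinal.sum fun Y : Shrink.{w} (Subtype Q) ↦
    c (F.obj ((equivShrink _).symm Y).1)), fun l _ hl X _ ↦ ?_⟩
  refine isCardinalPresentable_obj_of_powLT (hl.of_le (le_max_left _ _)) F (fun Y hY ↦ ?_) X
  obtain ⟨Y', hY', ⟨e⟩⟩ := hQ' Y hY
  have hle : c (F.obj Y') ≤ l := by
    refine le_trans ?_ (hl.of_le (le_max_right _ _)).lt.le
    simpa using Cardinal.le_sum (fun Y : Shrink.{w} (Subtype Q) ↦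
      c (F.obj ((equivShrink _).symm Y).1)) (equivShrink _ ⟨Y', hY'⟩)
  have := hc (F.obj Y')
  have : IsCardinalPresentable (F.obj Y') (c (F.obj Y')) := hc' _
  have := isCardinalPresentable_of_le (F.obj Y') hle
  exact isCardinalPresentable_of_iso (F.mapIso e.symm) l

end Uniformization

/-! ### Levelwise presentations of morphisms between directed colimits -/

section LevelwiseHom

variable {K : Type w} [PartialOrder K] {B : Type u} [Category.{v} B]

/-- A morphism between the colimits of two diagrams, presented by morphisms
`f k : X k ⟶ Y (s k)` that become compatible at the stages `m k k'`. -/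
structure LevelwiseHom (X Y : K ⥤ B) where
  /-- The stage of the target at which `f k` is defined. -/
  s : K → K
  /-- The component at `k`. -/
  f (k : K) : X.obj k ⟶ Y.obj (s k)
  /-- A stage at which the components at `k` and `k'` are compatible. -/
  m : K → K → K
  le_left {k k' : K} (h : k ≤ k') : s k ≤ m k k'
  le_right {k k' : K} (h : k ≤ k') : s k' ≤ m k k'
  comm {k k' : K} (h : k ≤ k') : f k ≫ Y.map (homOfLE (le_left h)) =
    X.map (homOfLE h) ≫ f k' ≫ Y.map (homOfLE (le_right h))

namespace LevelwiseHom

variable {X Y : K ⥤ B}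

/-- If the terms of `X` are `κ`-presentable, every morphism between the colimits is presented
levelwise. -/
lemma exists_of_isColimit {κ : Cardinal.{w}} [Fact κ.IsRegular] [IsCardinalFiltered K κ]
    (hX : ∀ k, IsCardinalPresentable (X.obj k) κ) (cX : Cocone X) {cY : Cocone Y}
    (hY : IsColimit cY) (α : cX.pt ⟶ cY.pt) :
    ∃ R : LevelwiseHom X Y, ∀ k, R.f k ≫ cY.ι.app (R.s k) = cX.ι.app k ≫ α := by
  have := essentiallySmallSelf.{w} K
  choose s f hf using fun k ↦
    IsCardinalPresentable.exists_hom_of_isColimit κ hY (cX.ι.app k ≫ α)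
  have key (q : K × K) : ∃ m : K, ∀ h : q.1 ≤ q.2, ∃ (h₁ : s q.1 ≤ m) (h₂ : s q.2 ≤ m),
      f q.1 ≫ Y.map (homOfLE h₁) = X.map (homOfLE h) ≫ f q.2 ≫ Y.map (homOfLE h₂) := by
    by_cases h : q.1 ≤ q.2
    · obtain ⟨m, a, b, hm⟩ := IsCardinalPresentable.exists_eq_of_isColimit κ hY (f q.1)
        (X.map (homOfLE h) ≫ f q.2) (by
          rw [Category.assoc, hf, hf, ← Category.assoc, cX.w])
      exact ⟨m, fun _ ↦ ⟨leOfHom a, leOfHom b, by simpa using! hm⟩⟩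
    · exact ⟨q.1, fun h' ↦ (h h').elim⟩
  choose m h₁ h₂ hm using key
  exact ⟨⟨s, f, fun k k' ↦ m (k, k'), fun h ↦ h₁ (_, _) h, fun h ↦ h₂ (_, _) h,
    fun h ↦ hm (_, _) h⟩, hf⟩

variable {S : Set K} {Z Z' : B}

lemma f_comp_ι (R : LevelwiseHom X Y) (hs : ∀ k ∈ S, R.s k ∈ S)
    (hm : ∀ k ∈ S, ∀ k' ∈ S, R.m k k' ∈ S) (y : PartialColimit Y S Z') {k k' : K} (hk : k ∈ S)
    (hk' : k' ∈ S) (h : k ≤ k') :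
    X.map (homOfLE h) ≫ R.f k' ≫ y.ι (R.s k') (hs k' hk') = R.f k ≫ y.ι (R.s k) (hs k hk) := by
  rw [← y.w (hs k hk) (hm k hk k' hk') (R.le_left h),
    ← y.w (hs k' hk') (hm k hk k' hk') (R.le_right h), reassoc_of% (R.comm h)]

/-- The morphism that a levelwise morphism induces on the partial colimits over a subset that is
closed under the functions `s` and `m`. -/
def onPartial (R : LevelwiseHom X Y) (hs : ∀ k ∈ S, R.s k ∈ S)
    (hm : ∀ k ∈ S, ∀ k' ∈ S, R.m k k' ∈ S) (x : PartialColimit X S Z)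
    (y : PartialColimit Y S Z') : Z ⟶ Z' :=
  x.desc (fun k hk ↦ R.f k ≫ y.ι (R.s k) (hs k hk)) (R.f_comp_ι hs hm y)

lemma ι_onPartial (R : LevelwiseHom X Y) (hs : ∀ k ∈ S, R.s k ∈ S)
    (hm : ∀ k ∈ S, ∀ k' ∈ S, R.m k k' ∈ S) (x : PartialColimit X S Z)
    (y : PartialColimit Y S Z') (k : K) (hk : k ∈ S) :
    x.ι k hk ≫ R.onPartial hs hm x y = R.f k ≫ y.ι (R.s k) (hs k hk) :=
  PartialColimit.fac _ _ (R.f_comp_ι hs hm y) _ _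

lemma ι_onPartial_assoc (R : LevelwiseHom X Y) (hs : ∀ k ∈ S, R.s k ∈ S)
    (hm : ∀ k ∈ S, ∀ k' ∈ S, R.m k k' ∈ S) (x : PartialColimit X S Z)
    (y : PartialColimit Y S Z') (k : K) (hk : k ∈ S) {W : B} (g : Z' ⟶ W) :
    x.ι k hk ≫ R.onPartial hs hm x y ≫ g = R.f k ≫ y.ι (R.s k) (hs k hk) ≫ g := by
  rw [← Category.assoc, ι_onPartial, Category.assoc]

/-- If `R` and `R'` present mutually inverse isomorphisms, their composite becomes the identity at a
stage `r k` for each `k`. -/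
lemma exists_comp_eq {κ : Cardinal.{w}} [Fact κ.IsRegular] [IsCardinalFiltered K κ]
    (hX : ∀ k, IsCardinalPresentable (X.obj k) κ) {cX : Cocone X} (hcX : IsColimit cX)
    {cY : Cocone Y} (e : cX.pt ≅ cY.pt)
    (R : LevelwiseHom X Y) (hR : ∀ k, R.f k ≫ cY.ι.app (R.s k) = cX.ι.app k ≫ e.hom)
    (R' : LevelwiseHom Y X) (hR' : ∀ k, R'.f k ≫ cX.ι.app (R'.s k) = cY.ι.app k ≫ e.inv) :
    ∃ r : K → K, ∀ k, ∃ (h₁ : k ≤ r k) (h₂ : R'.s (R.s k) ≤ r k),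
      R.f k ≫ R'.f (R.s k) ≫ X.map (homOfLE h₂) = X.map (homOfLE h₁) := by
  have := essentiallySmallSelf.{w} K
  refine Classical.axiomOfChoice (r := fun k m ↦ ∃ (h₁ : k ≤ m) (h₂ : R'.s (R.s k) ≤ m),
      R.f k ≫ R'.f (R.s k) ≫ X.map (homOfLE h₂) = X.map (homOfLE h₁)) fun k ↦ ?_
  obtain ⟨m, a, b, hm⟩ := IsCardinalPresentable.exists_eq_of_isColimit κ hcX
    (R.f k ≫ R'.f (R.s k)) (𝟙 (X.obj k)) (by
      rw [Category.assoc, hR', reassoc_of% (hR k)]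
      simp)
  exact ⟨m, leOfHom b, leOfHom a, by simpa using! hm⟩

/-- Over a subset that is also closed under `r`, the induced morphisms are inverse to each other. -/
lemma onPartial_comp_onPartial (R : LevelwiseHom X Y) (R' : LevelwiseHom Y X) {r : K → K}
    (hr : ∀ k, ∃ (h₁ : k ≤ r k) (h₂ : R'.s (R.s k) ≤ r k),
      R.f k ≫ R'.f (R.s k) ≫ X.map (homOfLE h₂) = X.map (homOfLE h₁))
    (hs : ∀ k ∈ S, R.s k ∈ S) (hm : ∀ k ∈ S, ∀ k' ∈ S, R.m k k' ∈ S)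
    (hs' : ∀ k ∈ S, R'.s k ∈ S) (hm' : ∀ k ∈ S, ∀ k' ∈ S, R'.m k k' ∈ S)
    (hrS : ∀ k ∈ S, r k ∈ S) (x : PartialColimit X S Z) (y : PartialColimit Y S Z') :
    R.onPartial hs hm x y ≫ R'.onPartial hs' hm' y x = 𝟙 Z :=
  x.hom_ext fun k hk ↦ by
    obtain ⟨h₁, h₂, h⟩ := hr k
    rw [ι_onPartial_assoc, ι_onPartial, Category.comp_id, ← x.w hk (hrS k hk) h₁,
      ← x.w (hs' _ (hs k hk)) (hrS k hk) h₂, reassoc_of% h]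

end LevelwiseHom

end LevelwiseHom

/-! ### Colimits in pseudopullbacks -/

section Pullback

open CategoricalPullback

variable {A : Type u₁} {B : Type u₂} {C : Type u₃}
  [Category.{v₁} A] [Category.{v₂} B] [Category.{v₃} C] {F : A ⥤ B} {G : C ⥤ B}

lemma comp_w_of_eq {x y z : CategoricalPullback F G} (f : x ⟶ y) (g : x ⟶ z)
    {a : y.fst ⟶ z.fst} {b : y.snd ⟶ z.snd} (ha : f.fst ≫ a = g.fst) (hb : f.snd ≫ b = g.snd) :
    F.map f.fst ≫ F.map a ≫ z.iso.hom = F.map f.fst ≫ y.iso.hom ≫ G.map b := by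
  rw [f.w_assoc, ← Functor.map_comp_assoc, ← Functor.map_comp, ha, hb, g.w]

/-- A cocone in a categorical pullback is a colimit if both projections are colimits and the first
one is preserved. -/
def isColimitOfProjections {J : Type u} [Category.{v} J] {Z : J ⥤ CategoricalPullback F G}
    (c : Cocone Z) (h₁ : IsColimit ((π₁ F G).mapCocone c)) (h₂ : IsColimit ((π₂ F G).mapCocone c))
    (h : IsColimit (F.mapCocone ((π₁ F G).mapCocone c))) : IsColimit c where
  desc s :=
    { fst := h₁.desc ((π₁ F G).mapCocone s)
      snd := h₂.desc ((π₂ F G).mapCocone s)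
      w := h.hom_ext fun j ↦ by
        have e₁ : (c.ι.app j).fst ≫ h₁.desc ((π₁ F G).mapCocone s) = (s.ι.app j).fst :=
          h₁.fac ((π₁ F G).mapCocone s) j
        have e₂ : (c.ι.app j).snd ≫ h₂.desc ((π₂ F G).mapCocone s) = (s.ι.app j).snd :=
          h₂.fac ((π₂ F G).mapCocone s) j
        exact comp_w_of_eq (c.ι.app j) (s.ι.app j) e₁ e₂ }
  fac s j := by
    ext
    · exact h₁.fac ((π₁ F G).mapCocone s) j
    · exact h₂.fac ((π₂ F G).mapCocone s) j
  uniq s m hm := by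
    ext
    · exact h₁.uniq ((π₁ F G).mapCocone s) m.fst fun j ↦ congrArg Hom.fst (hm j)
    · exact h₂.uniq ((π₂ F G).mapCocone s) m.snd fun j ↦ congrArg Hom.snd (hm j)

/-- Colimits in a pseudopullback are computed componentwise if `F` and `G` preserve them. -/
lemma exists_isColimit_projections {J : Type u} [Category.{v} J]
    (Z : J ⥤ CategoricalPullback F G)
    [HasColimit (Z ⋙ π₁ F G)] [HasColimit (Z ⋙ π₂ F G)]
    [PreservesColimit (Z ⋙ π₁ F G) F] [PreservesColimit (Z ⋙ π₂ F G) G] :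
    ∃ c : Cocone Z, Nonempty (IsColimit c) ∧ Nonempty (IsColimit ((π₁ F G).mapCocone c)) ∧
      Nonempty (IsColimit ((π₂ F G).mapCocone c)) := by
  let c₁ := colimit.isColimit (Z ⋙ π₁ F G)
  let c₂ := colimit.isColimit (Z ⋙ π₂ F G)
  let hF := isColimitOfPreserves F c₁
  let hG := isColimitOfPreserves G c₂
  let e : (Z ⋙ π₁ F G) ⋙ F ≅ (Z ⋙ π₂ F G) ⋙ G :=
    NatIso.ofComponents (fun j ↦ (Z.obj j).iso) (fun f ↦ (Z.map f).w)
  let c : Cocone Z :=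
    { pt := ⟨_, _, hF.coconePointsIsoOfNatIso hG e⟩
      ι.app j :=
        { fst := colimit.ι (Z ⋙ π₁ F G) j
          snd := colimit.ι (Z ⋙ π₂ F G) j
          w := hF.comp_coconePointsIsoOfNatIso_hom hG e j }
      ι.naturality j j' f := by
        ext
        · exact (colimit.cocone (Z ⋙ π₁ F G)).ι.naturality f
        · exact (colimit.cocone (Z ⋙ π₂ F G)).ι.naturality f }
  have h₁ : IsColimit ((π₁ F G).mapCocone c) := c₁
  have h₂ : IsColimit ((π₂ F G).mapCocone c) := c₂
  exact ⟨c, ⟨isColimitOfProjections c h₁ h₂ hF⟩, ⟨h₁⟩, ⟨h₂⟩⟩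

variable (F G)

lemma hasColimitsOfShape_categoricalPullback (J : Type u) [Category.{v} J]
    [HasColimitsOfShape J A] [HasColimitsOfShape J C]
    [PreservesColimitsOfShape J F] [PreservesColimitsOfShape J G] :
    HasColimitsOfShape J (CategoricalPullback F G) where
  has_colimit Z := by
    obtain ⟨c, ⟨hc⟩, -⟩ := exists_isColimit_projections Z
    exact ⟨c, hc⟩

lemma preservesColimitsOfShape_π₁ (J : Type u) [Category.{v} J]
    [HasColimitsOfShape J A] [HasColimitsOfShape J C]
    [PreservesColimitsOfShape J F] [PreservesColimitsOfShape J G] :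
    PreservesColimitsOfShape J (π₁ F G) where
  preservesColimit {Z} := by
    obtain ⟨c, ⟨hc⟩, ⟨h⟩, -⟩ := exists_isColimit_projections Z
    exact preservesColimit_of_preserves_colimit_cocone hc h

lemma preservesColimitsOfShape_π₂ (J : Type u) [Category.{v} J]
    [HasColimitsOfShape J A] [HasColimitsOfShape J C]
    [PreservesColimitsOfShape J F] [PreservesColimitsOfShape J G] :
    PreservesColimitsOfShape J (π₂ F G) where
  preservesColimit {Z} := by
    obtain ⟨c, ⟨hc⟩, -, ⟨h⟩⟩ := exists_isColimit_projections Z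
    exact preservesColimit_of_preserves_colimit_cocone hc h

end Pullback

/-! ### Presentable objects of pseudopullbacks -/

section AccessiblePullback

open CategoricalPullback

variable {A : Type u₁} {B : Type u₂} {C : Type u₃}
  [Category.{v₁} A] [Category.{v₂} B] [Category.{v₃} C] (F : A ⥤ B) (G : C ⥤ B)

/-- The presentability of `F.obj x.fst` accounts for the equation that the components of a morphism
in the pseudopullback have to satisfy in `B`. -/
lemma isCardinalPresentable_categoricalPullback {κ l : Cardinal.{w}} [Fact κ.IsRegular]
    [Fact l.IsRegular] (hl : κ ≤ l)
    [HasCardinalFilteredColimits A κ] [HasCardinalFilteredColimits C κ]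
    [F.IsCardinalAccessible κ] [G.IsCardinalAccessible κ] (x : CategoricalPullback F G)
    [IsCardinalPresentable x.fst l] [IsCardinalPresentable x.snd l]
    [IsCardinalPresentable (F.obj x.fst) l] : IsCardinalPresentable x l := by
  have key (J : Type w) [SmallCategory J] [IsCardinalFiltered J l]
      {Z : J ⥤ CategoricalPullback F G} (c : Cocone Z) (hc : IsColimit c) :
      Nonempty (IsColimit ((π₁ F G).mapCocone c)) ∧
      Nonempty (IsColimit ((π₂ F G).mapCocone c)) ∧
      Nonempty (IsColimit (G.mapCocone ((π₂ F G).mapCocone c))) := by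
    have := IsCardinalFiltered.of_le J hl
    have := HasCardinalFilteredColimits.hasColimitsOfShape A κ J
    have := HasCardinalFilteredColimits.hasColimitsOfShape C κ J
    have := F.preservesColimitsOfShape_of_isCardinalAccessible κ J
    have := G.preservesColimitsOfShape_of_isCardinalAccessible κ J
    have := preservesColimitsOfShape_π₁ F G J
    have := preservesColimitsOfShape_π₂ F G J
    exact ⟨⟨isColimitOfPreserves _ hc⟩, ⟨isColimitOfPreserves _ hc⟩,
      ⟨isColimitOfPreserves G (isColimitOfPreserves _ hc)⟩⟩
  refine isCardinalPresentable_of_exists (fun J _ _ Z c hc f ↦ ?_) fun J _ _ Z c hc j f g h ↦ ?_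
  · have := essentiallySmallSelf.{w} J
    have := isFiltered_of_isCardinalFiltered J l
    obtain ⟨⟨h₁⟩, ⟨h₂⟩, ⟨h₃⟩⟩ := key J c hc
    obtain ⟨j₁, g₁, hg₁⟩ := IsCardinalPresentable.exists_hom_of_isColimit l h₁ f.fst
    obtain ⟨j₂, g₂, hg₂⟩ := IsCardinalPresentable.exists_hom_of_isColimit l h₂ f.snd
    let j := IsFiltered.max j₁ j₂
    let a₁ : j₁ ⟶ j := IsFiltered.leftToMax j₁ j₂
    let a₂ : j₂ ⟶ j := IsFiltered.rightToMax j₁ j₂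
    let b₁ : x.fst ⟶ (Z.obj j).fst := g₁ ≫ (Z.map a₁).fst
    let b₂ : x.snd ⟶ (Z.obj j).snd := g₂ ≫ (Z.map a₂).snd
    have hb₁ : b₁ ≫ (c.ι.app j).fst = f.fst := by
      have : (Z.map a₁).fst ≫ (c.ι.app j).fst = (c.ι.app j₁).fst := congrArg Hom.fst (c.w a₁)
      exact (Category.assoc _ _ _).trans ((congrArg (g₁ ≫ ·) this).trans hg₁)
    have hb₂ : b₂ ≫ (c.ι.app j).snd = f.snd := by
      have : (Z.map a₂).snd ≫ (c.ι.app j).snd = (c.ι.app j₂).snd := congrArg Hom.snd (c.w a₂)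
      exact (Category.assoc _ _ _).trans ((congrArg (g₂ ≫ ·) this).trans hg₂)
    -- The two sides of the compatibility condition need only agree after passing to the colimit.
    have hw : (F.map b₁ ≫ (Z.obj j).iso.hom) ≫ G.map (c.ι.app j).snd =
        (x.iso.hom ≫ G.map b₂) ≫ G.map (c.ι.app j).snd := by
      have hc := (c.ι.app j).w
      have hf := f.w
      dsimp at hc hf
      rw [Category.assoc, Category.assoc, ← hc, ← Functor.map_comp, ← Functor.map_comp_assoc,
        hb₁, hb₂, hf]
    obtain ⟨k, a, ha⟩ := IsCardinalPresentable.exists_eq_of_isColimit' l h₃ _ _ hw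
    refine ⟨k, ⟨b₁ ≫ (Z.map a).fst, b₂ ≫ (Z.map a).snd, ?_⟩, ?_⟩
    · have ha' : (F.map b₁ ≫ (Z.obj j).iso.hom) ≫ G.map (Z.map a).snd =
        (x.iso.hom ≫ G.map b₂) ≫ G.map (Z.map a).snd := ha
      simpa using ha'
    · have e₁ : (Z.map a).fst ≫ (c.ι.app k).fst = (c.ι.app j).fst := congrArg Hom.fst (c.w a)
      have e₂ : (Z.map a).snd ≫ (c.ι.app k).snd = (c.ι.app j).snd := congrArg Hom.snd (c.w a)
      refine CategoricalPullback.hom_ext ?_ ?_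
      · exact (Category.assoc _ _ _).trans ((congrArg (b₁ ≫ ·) e₁).trans hb₁)
      · exact (Category.assoc _ _ _).trans ((congrArg (b₂ ≫ ·) e₂).trans hb₂)
  · have := essentiallySmallSelf.{w} J
    have := isFiltered_of_isCardinalFiltered J l
    obtain ⟨⟨h₁⟩, ⟨h₂⟩, -⟩ := key J c hc
    obtain ⟨k₁, a₁, e₁⟩ := IsCardinalPresentable.exists_eq_of_isColimit' l h₁ f.fst g.fst
      (congrArg Hom.fst h)
    obtain ⟨k₂, a₂, e₂⟩ := IsCardinalPresentable.exists_eq_of_isColimit' l h₂ f.snd g.snd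
      (congrArg Hom.snd h)
    obtain ⟨k, b₁, b₂, e⟩ := IsFiltered.span a₁ a₂
    refine ⟨k, a₁ ≫ b₁, CategoricalPullback.hom_ext ?_ ?_⟩
    · rw [Functor.map_comp]
      exact (Category.assoc _ _ _).symm.trans ((congrArg (· ≫ (Z.map b₁).fst) e₁).trans
        (Category.assoc _ _ _))
    · rw [e, Functor.map_comp]
      exact (Category.assoc _ _ _).symm.trans ((congrArg (· ≫ (Z.map b₂).snd) e₂).trans
        (Category.assoc _ _ _))

/-- The objects of the categorical pullback that have `l`-presentable components. -/
def hasPresentableComponents (l : Cardinal.{w}) [Fact l.IsRegular] :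
    ObjectProperty (CategoricalPullback F G) :=
  fun x ↦ IsCardinalPresentable x.fst l ∧ IsCardinalPresentable x.snd l

lemma locallySmall_categoricalPullback [LocallySmall.{w} A] [LocallySmall.{w} C] :
    LocallySmall.{w} (CategoricalPullback F G) where
  hom_small x y := small_of_injective
    (f := fun f : x ⟶ y ↦ ((f.fst, f.snd) : (x.fst ⟶ y.fst) × (x.snd ⟶ y.snd)))
    fun _ _ h ↦ CategoricalPullback.hom_ext (Prod.ext_iff.1 h).1 (Prod.ext_iff.1 h).2

lemma essentiallySmall_hasPresentableComponents (l : Cardinal.{w}) [Fact l.IsRegular]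
    [HasCardinalFilteredGenerator A l] [HasCardinalFilteredGenerator C l] [LocallySmall.{w} B] :
    ObjectProperty.EssentiallySmall.{w} (hasPresentableComponents F G l) := by
  obtain ⟨P, _, hP, hP'⟩ :=
    ObjectProperty.EssentiallySmall.exists_small_le.{w} (isCardinalPresentable A l)
  obtain ⟨Q, _, hQ, hQ'⟩ :=
    ObjectProperty.EssentiallySmall.exists_small_le.{w} (isCardinalPresentable C l)
  have (a : A) (c : C) : Small.{w} (F.obj a ≅ G.obj c) :=
    small_of_injective (f := fun e ↦ e.hom) fun e e' h ↦ Iso.ext h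
  let φ (i : Σ (a : Subtype P) (c : Subtype Q), F.obj a.1 ≅ G.obj c.1) :
      CategoricalPullback F G := ⟨_, _, i.2.2⟩
  refine ⟨ObjectProperty.ofObj φ, inferInstance, fun x hx ↦ ?_⟩
  obtain ⟨a, ha, ⟨e⟩⟩ := hP' _ hx.1
  obtain ⟨c, hc, ⟨e'⟩⟩ := hQ' _ hx.2
  exact ⟨_, ⟨⟨⟨a, ha⟩, ⟨c, hc⟩, (F.mapIso e).symm ≪≫ x.iso ≪≫ G.mapIso e'⟩⟩,
    ⟨CategoricalPullback.mkIso e e' (by simp [φ])⟩⟩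

end AccessiblePullback

/-! ### Accessibility of pseudopullbacks -/

section AccessiblePullback

open CategoricalPullback

variable {A : Type u₁} {B : Type u₂} {C : Type u₃}
  [Category.{v₁} A] [Category.{v₂} B] [Category.{v₃} C] (F : A ⥤ B) (G : C ⥤ B)

lemma PartialColimit.isCardinalPresentable {K : Type w} [PartialOrder K] {D : K ⥤ A} {S : Set K}
    {Z : A} (c : PartialColimit D S Z) [LocallySmall.{w} A] {l : Cardinal.{w}} [Fact l.IsRegular]
    (hD : ∀ k, IsCardinalPresentable (D.obj k) l) (hS : HasCardinalLT S l) :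
    IsCardinalPresentable Z l :=
  have (k : S) : IsCardinalPresentable ((subsetInclusion S ⋙ D).obj k) l := hD k.1
  isCardinalPresentable_of_isColimit _ c.isColimit l
    (hasCardinalLT_arrow_of_partialOrder (Cardinal.IsRegular.aleph0_le Fact.out) hS)

/-- Presentations of two objects can be reindexed by the product of their index categories. -/
lemma exists_common_directed_presentation {κ : Cardinal.{w}} [Fact κ.IsRegular]
    [IsCardinalAccessibleCategory A κ] [IsCardinalAccessibleCategory C κ] (a : A) (c : C) :
    ∃ (K : Type w) (_ : PartialOrder K) (_ : IsCardinalFiltered K κ),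
      Nonempty ((isCardinalPresentable A κ).ColimitOfShape K a) ∧
      Nonempty ((isCardinalPresentable C κ).ColimitOfShape K c) := by
  obtain ⟨I, _, _, ⟨p⟩⟩ :=
    (isCardinalFilteredGenerator_isCardinalPresentable A κ).exists_colimitsOfShape a
  obtain ⟨J, _, _, ⟨q⟩⟩ :=
    (isCardinalFilteredGenerator_isCardinalPresentable C κ).exists_colimitsOfShape c
  have := isFiltered_of_isCardinalFiltered I κ
  have := isFiltered_of_isCardinalFiltered J κ
  obtain ⟨K, _, _, T, _⟩ := IsCardinalFiltered.exists_cardinal_directed (I × J) κ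
  exact ⟨K, inferInstance, inferInstance, ⟨(p.reindex (CategoryTheory.Prod.fst I J)).reindex T⟩,
    ⟨(q.reindex (CategoryTheory.Prod.snd I J)).reindex T⟩⟩

/-- Every object of the pseudopullback is an `l`-directed colimit of objects with `l`-presentable
components, namely of the partial colimits over the good subsets of a common index. -/
theorem hasPresentableComponents_exists_colimitsOfShape {κ l : Cardinal.{w}} [Fact κ.IsRegular]
    [Fact l.IsRegular] (hl : PowLT κ l)
    [IsCardinalAccessibleCategory A κ] [IsCardinalAccessibleCategory C κ]
    [F.IsCardinalAccessible κ] [G.IsCardinalAccessible κ]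
    (hF : ∀ (X : A) [IsCardinalPresentable X κ], IsCardinalPresentable (F.obj X) κ)
    (hG : ∀ (X : C) [IsCardinalPresentable X κ], IsCardinalPresentable (G.obj X) κ)
    (x : CategoricalPullback F G) :
    ∃ (J : Type w) (_ : SmallCategory J) (_ : IsCardinalFiltered J l),
      (hasPresentableComponents F G l).colimitsOfShape J x := by
  have : Fact (PowLT κ l) := ⟨hl⟩
  obtain ⟨K, _, _, ⟨a⟩, ⟨c⟩⟩ := exists_common_directed_presentation (κ := κ) x.fst x.snd
  have := F.preservesColimitsOfShape_of_isCardinalAccessible κ K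
  have := G.preservesColimitsOfShape_of_isCardinalAccessible κ K
  have hX (k : K) : IsCardinalPresentable ((a.diag ⋙ F).obj k) κ :=
    have : IsCardinalPresentable (a.diag.obj k) κ := a.prop_diag_obj k
    hF (a.diag.obj k)
  have hY (k : K) : IsCardinalPresentable ((c.diag ⋙ G).obj k) κ :=
    have : IsCardinalPresentable (c.diag.obj k) κ := c.prop_diag_obj k
    hG (c.diag.obj k)
  have hcX : IsColimit (F.mapCocone a.cocone) := isColimitOfPreserves F a.isColimit
  have hcY : IsColimit (G.mapCocone c.cocone) := isColimitOfPreserves G c.isColimit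
  let e : (F.mapCocone a.cocone).pt ≅ (G.mapCocone c.cocone).pt := x.iso
  -- `R` and `R'` present the structural isomorphism and its inverse levelwise.
  obtain ⟨R, hR⟩ := LevelwiseHom.exists_of_isColimit hX (F.mapCocone a.cocone) hcY e.hom
  obtain ⟨R', hR'⟩ := LevelwiseHom.exists_of_isColimit hY (G.mapCocone c.cocone) hcX e.inv
  obtain ⟨r, hr⟩ := LevelwiseHom.exists_comp_eq hX hcX e R hR R' hR'
  obtain ⟨r', hr'⟩ := LevelwiseHom.exists_comp_eq hY hcY e.symm R' hR' R hR
  -- Subsets closed under these six functions carry the isomorphism, its inverse, and the proofs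
  -- that they are mutually inverse.
  let op : ULift.{w} (Fin 6) → K → K → K := fun i ↦
    ![fun k _ ↦ R.s k, R.m, fun k _ ↦ R'.s k, R'.m, fun k _ ↦ r k, fun k _ ↦ r' k] i.down
  let p := IsGoodSubset κ l op
  have hs (S : Subtype p) : ∀ k ∈ S.1, R.s k ∈ S.1 := fun k hk ↦ S.2.op_mem ⟨0⟩ hk hk
  have hm (S : Subtype p) : ∀ k ∈ S.1, ∀ k' ∈ S.1, R.m k k' ∈ S.1 :=
    fun k hk k' hk' ↦ S.2.op_mem ⟨1⟩ hk hk'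
  have hs' (S : Subtype p) : ∀ k ∈ S.1, R'.s k ∈ S.1 := fun k hk ↦ S.2.op_mem ⟨2⟩ hk hk
  have hm' (S : Subtype p) : ∀ k ∈ S.1, ∀ k' ∈ S.1, R'.m k k' ∈ S.1 :=
    fun k hk k' hk' ↦ S.2.op_mem ⟨3⟩ hk hk'
  have hrS (S : Subtype p) : ∀ k ∈ S.1, r k ∈ S.1 := fun k hk ↦ S.2.op_mem ⟨4⟩ hk hk
  have hrS' (S : Subtype p) : ∀ k ∈ S.1, r' k ∈ S.1 := fun k hk ↦ S.2.op_mem ⟨5⟩ hk hk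
  have := fun S : Subtype p ↦ hasColimit_goodSubset (κ := κ) (l := l) (op := op) a.diag S
  have := fun S : Subtype p ↦ hasColimit_goodSubset (κ := κ) (l := l) (op := op) c.diag S
  have := isDirectedOrder_goodSubsets (κ := κ) (l := l) op
  have (S : Subtype p) : PreservesColimit (subsetInclusion S.1 ⋙ a.diag) F :=
    have := S.2.isCardinalFiltered
    have := F.preservesColimitsOfShape_of_isCardinalAccessible κ S.1
    inferInstance
  have (S : Subtype p) : PreservesColimit (subsetInclusion S.1 ⋙ c.diag) G :=
    have := S.2.isCardinalFiltered
    have := G.preservesColimitsOfShape_of_isCardinalAccessible κ S.1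
    inferInstance
  let X (S : Subtype p) := (partialColimit p a.diag S).map F
  let Y (S : Subtype p) := (partialColimit p c.diag S).map G
  let ψ (S : Subtype p) : F.obj ((partialColimits p a.diag).obj S) ≅
      G.obj ((partialColimits p c.diag).obj S) :=
    { hom := R.onPartial (hs S) (hm S) (X S) (Y S)
      inv := R'.onPartial (hs' S) (hm' S) (Y S) (X S)
      hom_inv_id := LevelwiseHom.onPartial_comp_onPartial R R' hr _ _ _ _ (hrS S) _ _
      inv_hom_id := LevelwiseHom.onPartial_comp_onPartial R' R hr' _ _ _ _ (hrS' S) _ _ }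
  have hψ (S : Subtype p) (k : K) (hk : k ∈ S.1) :
      F.map ((partialColimit p a.diag S).ι k hk) ≫ (ψ S).hom =
        R.f k ≫ G.map ((partialColimit p c.diag S).ι (R.s k) (hs S k hk)) :=
    R.ι_onPartial (hs S) (hm S) (X S) (Y S) k hk
  let H : Subtype p ⥤ CategoricalPullback F G :=
    { obj S := ⟨_, _, ψ S⟩
      map {S T} f :=
        { fst := (partialColimits p a.diag).map f
          snd := (partialColimits p c.diag).map f
          w := (X S).hom_ext fun k hk ↦ by
            change F.map ((partialColimit p a.diag S).ι k hk) ≫ _ =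
              F.map ((partialColimit p a.diag S).ι k hk) ≫ _
            rw [reassoc_of% (hψ S k hk), ← Functor.map_comp_assoc, ← Functor.map_comp,
              partialColimit_ι_map, partialColimit_ι_map, hψ] }
      map_id S := by ext <;> simp
      map_comp f g := by ext <;> simp }
  let cH : Cocone H :=
    { pt := x
      ι.app S :=
        { fst := (partialColimitsCocone p a.cocone).ι.app S
          snd := (partialColimitsCocone p c.cocone).ι.app S
          w := (X S).hom_ext fun k hk ↦ by
            have e₁ := partialColimit_ι_cocone p a.cocone S k hk
            have e₂ := partialColimit_ι_cocone p c.cocone S (R.s k) (hs S k hk)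
            have e₁' := (F.map_comp _ _).symm.trans (congrArg F.map e₁)
            have e₂' := (G.map_comp _ _).symm.trans (congrArg G.map e₂)
            exact ((Category.assoc _ _ _).symm.trans (congrArg (· ≫ x.iso.hom) e₁')).trans <|
              ((hR k).symm.trans (congrArg (R.f k ≫ ·) e₂'.symm)).trans <|
              ((Category.assoc _ _ _).symm.trans (congrArg (· ≫ G.map _) (hψ S k hk).symm)).trans
                (Category.assoc _ _ _) }
      ι.naturality S T f := by
        ext
        · exact (partialColimitsCocone p a.cocone).ι.naturality f
        · exact (partialColimitsCocone p c.cocone).ι.naturality f }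
  have hcov := exists_mem_isGoodSubset (κ := κ) (l := l) op
  have := IsCardinalFiltered.of_le (Subtype p) hl.lt.le
  have := F.preservesColimitsOfShape_of_isCardinalAccessible κ (Subtype p)
  have h₁ : IsColimit ((π₁ F G).mapCocone cH) :=
    isColimitPartialColimitsCocone hcov a.isColimit
  have h₂ : IsColimit ((π₂ F G).mapCocone cH) :=
    isColimitPartialColimitsCocone hcov c.isColimit
  refine ⟨Subtype p, inferInstance, isCardinalFiltered_goodSubsets op, ⟨
    { diag := H
      ι := cH.ι
      isColimit := isColimitOfProjections cH h₁ h₂ (isColimitOfPreserves F h₁)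
      prop_diag_obj S := ⟨?_, ?_⟩ }⟩⟩
  · exact (partialColimit p a.diag S).isCardinalPresentable (fun k ↦
      isCardinalPresentable_monotone A hl.lt.le _ (a.prop_diag_obj k)) S.2.hasCardinalLT
  · exact (partialColimit p c.diag S).isCardinalPresentable (fun k ↦
      isCardinalPresentable_monotone C hl.lt.le _ (c.prop_diag_obj k)) S.2.hasCardinalLT

theorem isCardinalAccessibleCategory_categoricalPullback {κ l : Cardinal.{w}} [Fact κ.IsRegular]
    [Fact l.IsRegular] (hl : PowLT κ l)
    [IsCardinalAccessibleCategory A κ] [IsCardinalAccessibleCategory C κ] [LocallySmall.{w} B]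
    [F.IsCardinalAccessible κ] [G.IsCardinalAccessible κ]
    (hF : ∀ (X : A) [IsCardinalPresentable X κ], IsCardinalPresentable (F.obj X) κ)
    (hG : ∀ (X : C) [IsCardinalPresentable X κ], IsCardinalPresentable (G.obj X) κ) :
    IsCardinalAccessibleCategory (CategoricalPullback F G) l := by
  have := isCardinalAccessibleCategory_of_powLT (A := A) hl
  have := isCardinalAccessibleCategory_of_powLT (A := C) hl
  have : LocallySmall.{w} (CategoricalPullback F G) := locallySmall_categoricalPullback F G
  have := essentiallySmall_hasPresentableComponents F G l
  have hP : (hasPresentableComponents F G l).IsCardinalFilteredGenerator l :=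
    { le_isCardinalPresentable x hx := by
        have := hx.1
        have := hx.2
        have := isCardinalPresentable_obj_of_powLT hl F (fun X _ ↦
          have := hF X
          isCardinalPresentable_of_le _ hl.lt.le) x.fst
        exact isCardinalPresentable_categoricalPullback F G hl.lt.le x
      exists_colimitsOfShape := hasPresentableComponents_exists_colimitsOfShape F G hl hF hG }
  have := hP.hasCardinalFilteredGenerator
  have : HasCardinalFilteredColimits (CategoricalPullback F G) l := ⟨fun J _ _ ↦
    have := HasCardinalFilteredColimits.hasColimitsOfShape A l J
    have := HasCardinalFilteredColimits.hasColimitsOfShape C l J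
    have := IsCardinalFiltered.of_le J hl.lt.le
    have := F.preservesColimitsOfShape_of_isCardinalAccessible κ J
    have := G.preservesColimitsOfShape_of_isCardinalAccessible κ J
    hasColimitsOfShape_categoricalPullback F G J⟩
  constructor

/-- Pseudopullbacks of accessible functors are accessible, and so are their projections. -/
theorem isAccessibleCategory_categoricalPullback [IsAccessibleCategory.{w} A]
    [IsAccessibleCategory.{w} B] [IsAccessibleCategory.{w} C] [F.IsAccessible.{w}]
    [G.IsAccessible.{w}] : IsAccessibleCategory.{w} (CategoricalPullback F G) ∧
      (π₁ F G).IsAccessible.{w} ∧ (π₂ F G).IsAccessible.{w} := by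
  obtain ⟨ν₁, h₁⟩ := exists_isCardinalAccessibleCategory.{w} A
  obtain ⟨ν₂, h₂⟩ := exists_isCardinalAccessibleCategory.{w} C
  obtain ⟨ν₃, h₃⟩ := exists_isCardinalAccessible.{w} F
  obtain ⟨ν₄, h₄⟩ := exists_isCardinalAccessible.{w} G
  obtain ⟨ν₅, h₅⟩ := exists_isCardinalPresentable_obj.{w} F
  obtain ⟨ν₆, h₆⟩ := exists_isCardinalPresentable_obj.{w} G
  obtain ⟨κ, hκ, h⟩ := exists_powLT (fun i : ULift.{w} (Fin 6) ↦
    ![ν₁, ν₂, ν₃, ν₄, ν₅, ν₆] i.down)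
  have : Fact κ.IsRegular := ⟨hκ⟩
  obtain ⟨l, hl, h'⟩ := exists_powLT (fun _ : PUnit.{w + 1} ↦ κ)
  have : Fact l.IsRegular := ⟨hl⟩
  have := h₁ κ (h ⟨0⟩)
  have := h₂ κ (h ⟨1⟩)
  have := h₃ κ (h ⟨2⟩)
  have := h₄ κ (h ⟨3⟩)
  have : LocallySmall.{w} B := by
    obtain ⟨κ, _, _⟩ := IsAccessibleCategory.exists_cardinal.{w} B
    infer_instance
  have hP (J : Type w) [SmallCategory J] [IsCardinalFiltered J κ] :
      PreservesColimitsOfShape J (π₁ F G) ∧ PreservesColimitsOfShape J (π₂ F G) := by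
    have := HasCardinalFilteredColimits.hasColimitsOfShape A κ J
    have := HasCardinalFilteredColimits.hasColimitsOfShape C κ J
    have := F.preservesColimitsOfShape_of_isCardinalAccessible κ J
    have := G.preservesColimitsOfShape_of_isCardinalAccessible κ J
    exact ⟨preservesColimitsOfShape_π₁ F G J, preservesColimitsOfShape_π₂ F G J⟩
  exact ⟨⟨l, inferInstance, isCardinalAccessibleCategory_categoricalPullback F G (h' ⟨⟩)
    (h₅ κ (h ⟨4⟩)) (h₆ κ (h ⟨5⟩))⟩, ⟨κ, inferInstance, ⟨fun J _ _ ↦ (hP J).1⟩⟩,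
    ⟨κ, inferInstance, ⟨fun J _ _ ↦ (hP J).2⟩⟩⟩

end AccessiblePullback

/-! ### Products of accessible categories -/

section Products

lemma isCardinalAccessible_const (A : Type u₁) [Category.{v₁} A] {C : Type u₃} [Category.{v₃} C]
    (X : C) (κ : Cardinal.{w}) [Fact κ.IsRegular] :
    ((Functor.const A).obj X).IsCardinalAccessible κ := by
  refine ⟨fun J _ _ ↦ ⟨fun {F} ↦ ⟨fun {c} _ ↦ ⟨?_⟩⟩⟩⟩
  have := isFiltered_of_isCardinalFiltered J κ
  have : IsConnected J := IsFiltered.isConnected J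
  exact (isColimitConstCocone J X).ofIsoColimit (Cocone.ext (Iso.refl _) fun _ ↦ Category.comp_id _)

lemma isAccessible_const (A : Type u₁) [Category.{v₁} A] {C : Type u₃} [Category.{v₃} C] (X : C) :
    ((Functor.const A).obj X).IsAccessible.{w} :=
  have := Cardinal.fact_isRegular_aleph0.{w}
  ⟨Cardinal.aleph0, inferInstance, isCardinalAccessible_const A X _⟩

variable (A : Type u₁) [Category.{v₁} A] (C : Type u₃) [Category.{v₃} C]

/-- The product of two categories as the pseudopullback of two constant functors. Their value, the
empty type, has no endomorphism other than the identity, so that the comparison of the two values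
carries no information. -/
def prodToCategoricalPullback : A × C ⥤
    CategoricalPullback ((Functor.const A).obj PEmpty.{w + 1})
      ((Functor.const C).obj PEmpty.{w + 1}) where
  obj x := ⟨x.1, x.2, Iso.refl _⟩
  map f := { fst := f.1, snd := f.2 }

instance : (prodToCategoricalPullback.{w} A C).IsEquivalence where
  faithful := ⟨fun {x y f g} h ↦ Prod.ext (congrArg CategoricalPullback.Hom.fst h)
    (congrArg CategoricalPullback.Hom.snd h)⟩
  full := ⟨fun f ↦ ⟨(f.fst, f.snd), rfl⟩⟩
  essSurj := ⟨fun x ↦ ⟨(x.fst, x.snd), ⟨CategoricalPullback.mkIso (Iso.refl _) (Iso.refl _) (by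
    ext ⟨⟩)⟩⟩⟩

variable [IsAccessibleCategory.{w} A] [IsAccessibleCategory.{w} C]

lemma isAccessibleCategory_prod : IsAccessibleCategory.{w} (A × C) := by
  have := isAccessible_const.{w} A PEmpty.{w + 1}
  have := isAccessible_const.{w} C PEmpty.{w + 1}
  have := (isAccessibleCategory_categoricalPullback.{w} ((Functor.const A).obj PEmpty.{w + 1})
      ((Functor.const C).obj PEmpty.{w + 1})).1
  exact (prodToCategoricalPullback.{w} A C).asEquivalence.symm.isAccessibleCategory

lemma isAccessible_of_preservesColimits {A : Type u₁} [Category.{v₁} A] {C : Type u₃}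
    [Category.{v₃} C] (F : A ⥤ C) [PreservesColimitsOfSize.{w, w} F] : F.IsAccessible.{w} :=
  ⟨Cardinal.aleph0, Cardinal.fact_isRegular_aleph0,
    have := Cardinal.fact_isRegular_aleph0.{w}; inferInstance⟩

lemma isAccessible_prodFst : (CategoryTheory.Prod.fst A C).IsAccessible.{w} := by
  have := isAccessible_const.{w} A PEmpty.{w + 1}
  have := isAccessible_const.{w} C PEmpty.{w + 1}
  have := (isAccessibleCategory_categoricalPullback.{w} ((Functor.const A).obj PEmpty.{w + 1})
      ((Functor.const C).obj PEmpty.{w + 1})).2.1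
  have := isAccessible_of_preservesColimits.{w} (prodToCategoricalPullback.{w} A C)
  exact inferInstanceAs (prodToCategoricalPullback.{w} A C ⋙
    CategoricalPullback.π₁ _ _).IsAccessible

lemma isAccessible_prodSnd : (CategoryTheory.Prod.snd A C).IsAccessible.{w} := by
  have := isAccessible_const.{w} A PEmpty.{w + 1}
  have := isAccessible_const.{w} C PEmpty.{w + 1}
  have := (isAccessibleCategory_categoricalPullback.{w} ((Functor.const A).obj PEmpty.{w + 1})
      ((Functor.const C).obj PEmpty.{w + 1})).2.2
  have := isAccessible_of_preservesColimits.{w} (prodToCategoricalPullback.{w} A C)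
  exact inferInstanceAs (prodToCategoricalPullback.{w} A C ⋙
    CategoricalPullback.π₂ _ _).IsAccessible

end Products

/-! ### Functors into products and arrow categories -/

section FunctorsIntoProducts

variable {A : Type u₁} [Category.{v₁} A] {B : Type u₂} [Category.{v₂} B]
  {C : Type u₃} [Category.{v₃} C]

/-- `H` is accessible if it preserves all colimits that are preserved by two accessible functors. -/
lemma isAccessible_of_forall {F : A ⥤ B} {G : A ⥤ C} [F.IsAccessible.{w}] [G.IsAccessible.{w}]
    {D : Type u} [Category.{v} D] (H : A ⥤ D)
    (h : ∀ (J : Type w) [SmallCategory J], PreservesColimitsOfShape J F →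
      PreservesColimitsOfShape J G → PreservesColimitsOfShape J H) :
    H.IsAccessible.{w} := by
  obtain ⟨ν₁, h₁⟩ := exists_isCardinalAccessible.{w} F
  obtain ⟨ν₂, h₂⟩ := exists_isCardinalAccessible.{w} G
  obtain ⟨κ, hκ, hν⟩ := exists_powLT (fun b : ULift.{w} Bool ↦ cond b.down ν₁ ν₂)
  have : Fact κ.IsRegular := ⟨hκ⟩
  have := h₁ κ (hν ⟨true⟩)
  have := h₂ κ (hν ⟨false⟩)
  exact ⟨κ, inferInstance, ⟨fun J _ _ ↦ h J
    (F.preservesColimitsOfShape_of_isCardinalAccessible κ J)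
    (G.preservesColimitsOfShape_of_isCardinalAccessible κ J)⟩⟩

lemma isAccessible_prod' (F : A ⥤ B) (G : A ⥤ C) [F.IsAccessible.{w}] [G.IsAccessible.{w}] :
    (F.prod' G).IsAccessible.{w} := by
  refine isAccessible_of_forall (F := F) (G := G) _ fun J _ _ _ ↦ ⟨fun {Z} ↦ ⟨fun {c} hc ↦ ⟨?_⟩⟩⟩
  have h₁ := isColimitOfPreserves F hc
  have h₂ := isColimitOfPreserves G hc
  let s₁ (s : Cocone (Z ⋙ F.prod' G)) : Cocone (Z ⋙ F) := (CategoryTheory.Prod.fst B C).mapCocone s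
  let s₂ (s : Cocone (Z ⋙ F.prod' G)) : Cocone (Z ⋙ G) := (CategoryTheory.Prod.snd B C).mapCocone s
  exact
    { desc s := (h₁.desc (s₁ s), h₂.desc (s₂ s))
      fac s j := Prod.ext (h₁.fac (s₁ s) j) (h₂.fac (s₂ s) j)
      uniq s m hm := Prod.ext (h₁.uniq (s₁ s) m.1 fun j ↦ congrArg Prod.fst (hm j))
        (h₂.uniq (s₂ s) m.2 fun j ↦ congrArg Prod.snd (hm j)) }

/-- Colimits in the category of arrows are computed at the domain and at the codomain. -/
lemma isAccessible_arrow (F : A ⥤ Arrow B) [(F ⋙ Arrow.leftFunc).IsAccessible.{w}]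
    [(F ⋙ Arrow.rightFunc).IsAccessible.{w}] : F.IsAccessible.{w} := by
  refine isAccessible_of_forall (F := F ⋙ Arrow.leftFunc) (G := F ⋙ Arrow.rightFunc) _
    fun J _ _ _ ↦ ⟨fun {Z} ↦ ⟨fun {c} hc ↦ ⟨?_⟩⟩⟩
  exact Comma.fstSndJointlyReflectColimit
    (isColimitOfPreserves (F ⋙ Arrow.leftFunc) hc) (isColimitOfPreserves (F ⋙ Arrow.rightFunc) hc)

end FunctorsIntoProducts

/-! ### Disjoint unions of categories -/

section Sigma

variable {ι : Type w} {M : ι → Type u} [∀ i, Category.{v} (M i)]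

/-- There are morphisms only within one summand of a disjoint union. -/
lemma fst_eq_of_hom {x y : Σ i, M i} (f : x ⟶ y) : x.1 = y.1 := by
  obtain ⟨f⟩ := f
  rfl

/-- A filtered diagram in a disjoint union stays in one summand. -/
lemma exists_iso_comp_incl {J : Type u₁} [Category.{v₁} J] [IsFiltered J] (Z : J ⥤ Σ i, M i) :
    ∃ (i : ι) (G : J ⥤ M i), Nonempty (G ⋙ Sigma.incl i ≅ Z) := by
  let j₀ : J := IsFiltered.nonempty.some
  have h (j : J) : (Sigma.incl (Z.obj j₀).1 : _ ⥤ Σ i, M i).essImage (Z.obj j) := by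
    have e : (Z.obj j₀).1 = (Z.obj j).1 :=
      (fst_eq_of_hom (Z.map (IsFiltered.leftToMax j₀ j))).trans
        (fst_eq_of_hom (Z.map (IsFiltered.rightToMax j₀ j))).symm
    generalize Z.obj j = x at e
    generalize (Z.obj j₀).1 = i at e
    subst e
    exact ⟨x.2, ⟨Iso.refl _⟩⟩
  exact ⟨_, _, ⟨Functor.essImage.liftFunctorCompIso Z _ h⟩⟩

lemma preservesColimitsOfShape_incl {J : Type u₁} [Category.{v₁} J] [Nonempty J] (i : ι) :
    PreservesColimitsOfShape J (Sigma.incl i : _ ⥤ Σ i, M i) where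
  preservesColimit {Z} := ⟨fun {c} hc ↦ ⟨by
    have desc (s : Cocone (Z ⋙ (Sigma.incl i : _ ⥤ Σ i, M i))) :
        ∃ d : ((Sigma.incl i : _ ⥤ Σ i, M i).mapCocone c).pt ⟶ s.pt,
          ∀ j, ((Sigma.incl i : _ ⥤ Σ i, M i).mapCocone c).ι.app j ≫ d = s.ι.app j := by
      obtain ⟨⟨i', y⟩, α⟩ := s
      obtain rfl : i = i' := fst_eq_of_hom (α.app (Classical.arbitrary J))
      let a (j : J) : (Sigma.incl i).obj (Z.obj j) ⟶ (Sigma.incl i).obj y := α.app j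
      let p (j : J) : Z.obj j ⟶ y := (Sigma.incl i).preimage (a j)
      have hp (j : J) : (Sigma.incl i).map (p j) = a j := (Sigma.incl i).map_preimage (a j)
      have ha {j j' : J} (f : j ⟶ j') : (Sigma.incl i).map (Z.map f) ≫ a j' = a j :=
        (α.naturality f).trans (Category.comp_id (α.app j))
      let s' : Cocone Z :=
        { pt := y
          ι.app := p
          ι.naturality j j' f := by
            refine Eq.trans ?_ (Category.comp_id (p j)).symm
            refine (Sigma.incl i).map_injective ?_
            rw [Functor.map_comp, hp, hp]
            exact ha f }
      refine ⟨(Sigma.incl i).map (hc.desc s'), fun j ↦ ?_⟩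
      exact ((Sigma.incl i).map_comp _ _).symm.trans
        ((congrArg (Sigma.incl i).map (hc.fac s' j)).trans (hp j))
    have hom_ext (x : Σ i, M i) (m m' : (Sigma.incl i).obj c.pt ⟶ x)
        (h : ∀ j, (Sigma.incl i).map (c.ι.app j) ≫ m = (Sigma.incl i).map (c.ι.app j) ≫ m') :
        m = m' := by
      obtain ⟨i', y⟩ := x
      obtain rfl : i = i' := fst_eq_of_hom m
      obtain ⟨m, rfl⟩ := (Sigma.incl i).map_surjective (Y := y) m
      obtain ⟨m', rfl⟩ := (Sigma.incl i).map_surjective (Y := y) m'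
      exact congrArg _ (hc.hom_ext fun j ↦ (Sigma.incl i).map_injective
        (((Sigma.incl i).map_comp _ _).trans ((h j).trans ((Sigma.incl i).map_comp _ _).symm)))
    choose d hd using desc
    exact
      { desc := d
        fac := hd
        uniq s m hm := hom_ext _ _ _ fun j ↦ (hm j).trans (hd s j).symm }⟩⟩

lemma isCardinalAccessible_of_incl {D : Type u₁} [Category.{v₁} D] (κ : Cardinal.{w})
    [Fact κ.IsRegular] [∀ i, HasCardinalFilteredColimits (M i) κ] (H : (Σ i, M i) ⥤ D)
    (h : ∀ i, (Sigma.incl i ⋙ H).IsCardinalAccessible κ) : H.IsCardinalAccessible κ where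
  preservesColimitOfShape J _ _ := ⟨fun {Z} ↦ by
    have := isFiltered_of_isCardinalFiltered J κ
    obtain ⟨i, G, ⟨e⟩⟩ := exists_iso_comp_incl Z
    have := HasCardinalFilteredColimits.hasColimitsOfShape (M i) κ J
    have : Nonempty J := IsFiltered.nonempty
    have := preservesColimitsOfShape_incl (J := J) (M := M) i
    have := (Sigma.incl i ⋙ H).preservesColimitsOfShape_of_isCardinalAccessible κ J
    have : PreservesColimit (G ⋙ Sigma.incl i) H := preservesColimit_of_preserves_colimit_cocone
      (isColimitOfPreserves (Sigma.incl i) (colimit.isColimit G))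
      (isColimitOfPreserves (Sigma.incl i ⋙ H) (colimit.isColimit G))
    exact preservesColimit_of_iso_diagram H e⟩

lemma hasCardinalFilteredColimits_sigma (κ : Cardinal.{w}) [Fact κ.IsRegular]
    [∀ i, HasCardinalFilteredColimits (M i) κ] : HasCardinalFilteredColimits (Σ i, M i) κ where
  hasColimitsOfShape J _ _ := ⟨fun Z ↦ by
    have := isFiltered_of_isCardinalFiltered J κ
    obtain ⟨i, G, ⟨e⟩⟩ := exists_iso_comp_incl Z
    have := HasCardinalFilteredColimits.hasColimitsOfShape (M i) κ J
    have : Nonempty J := IsFiltered.nonempty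
    have := preservesColimitsOfShape_incl (J := J) (M := M) i
    have : HasColimit (G ⋙ (Sigma.incl i : _ ⥤ Σ i, M i)) :=
      ⟨⟨_, isColimitOfPreserves (Sigma.incl i) (colimit.isColimit G)⟩⟩
    exact hasColimit_of_iso e.symm⟩

/-- On the summand of `X` the functor represented by `X` is the original one, and on the other
summands it is constant with empty value. -/
lemma isCardinalPresentable_incl_obj (κ : Cardinal.{w}) [Fact κ.IsRegular]
    [∀ i, HasCardinalFilteredColimits (M i) κ] (i : ι) (X : M i) [IsCardinalPresentable X κ] :
    IsCardinalPresentable ((Sigma.incl i : _ ⥤ Σ i, M i).obj X) κ := by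
  refine isCardinalAccessible_of_incl κ _ fun i' ↦ ?_
  by_cases h : i = i'
  · subst h
    exact Functor.isCardinalAccessible_of_natIso (F := uliftCoyoneda.{max w u}.obj (Opposite.op X))
      (NatIso.ofComponents (fun Y ↦ (Equiv.ulift.trans
        (Functor.FullyFaithful.ofFullyFaithful (Sigma.incl i : _ ⥤ Σ i, M i)).homEquiv).toIso)
        (by
          intro Y Y' f
          ext g
          exact (Sigma.incl i).map_comp _ _)) κ
  · have := isCardinalAccessible_const (M i') PEmpty.{max w u v + 1} κ
    have (Y : M i') : IsEmpty ((Sigma.incl i).obj X ⟶ (Sigma.incl i' : _ ⥤ Σ i, M i).obj Y) :=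
      ⟨fun f ↦ h (fst_eq_of_hom f)⟩
    exact Functor.isCardinalAccessible_of_natIso
      (F := (Functor.const (M i')).obj PEmpty.{max w u v + 1})
      (G := Sigma.incl i' ⋙ coyoneda.obj (Opposite.op ((Sigma.incl i).obj X)))
      (NatIso.ofComponents (fun Y ↦ (Equiv.equivOfIsEmpty PEmpty
          ((Sigma.incl i).obj X ⟶ (Sigma.incl i' : _ ⥤ Σ i, M i).obj Y)).toIso)
        (by
          intro Y Y' f
          ext ⟨⟩)) κ

lemma locallySmall_sigma [∀ i, LocallySmall.{w} (M i)] : LocallySmall.{w} (Σ i, M i) where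
  hom_small := by
    rintro ⟨i, X⟩ ⟨i', Y⟩
    by_cases h : i = i'
    · subst h
      exact small_of_surjective (α := X ⟶ Y) (f := (Sigma.incl i).map)
        (Sigma.incl i).map_surjective
    · have : IsEmpty ((⟨i, X⟩ : Σ i, M i) ⟶ ⟨i', Y⟩) := ⟨fun f ↦ h (fst_eq_of_hom f)⟩
      infer_instance

lemma isCardinalAccessibleCategory_sigma (κ : Cardinal.{w}) [Fact κ.IsRegular]
    [∀ i, IsCardinalAccessibleCategory (M i) κ] : IsCardinalAccessibleCategory (Σ i, M i) κ := by
  have := locallySmall_sigma.{w} (M := M)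
  let P : ObjectProperty (Σ i, M i) := ⨆ i, (isCardinalPresentable (M i) κ).map (Sigma.incl i)
  have hP : P.IsCardinalFilteredGenerator κ :=
    { le_isCardinalPresentable := by
        refine iSup_le fun i ↦ ?_
        rintro X ⟨Y, hY, ⟨e⟩⟩
        have : IsCardinalPresentable Y κ := hY
        have := isCardinalPresentable_incl_obj κ i Y
        exact isCardinalPresentable_of_iso e κ
      exists_colimitsOfShape := by
        rintro ⟨i, X⟩
        obtain ⟨Q, _, hQ⟩ := HasCardinalFilteredGenerator.exists_generator (M i) κ
        obtain ⟨J, _, _, ⟨p⟩⟩ := hQ.exists_colimitsOfShape X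
        have := isFiltered_of_isCardinalFiltered J κ
        have : Nonempty J := IsFiltered.nonempty
        have := preservesColimitsOfShape_incl (J := J) (M := M) i
        refine ⟨J, inferInstance, inferInstance, ⟨p.toColimitPresentation.map (Sigma.incl i), ?_⟩⟩
        intro j
        have h : (isCardinalPresentable (M i) κ).map (Sigma.incl i) ≤ P :=
          le_iSup (fun i ↦ (isCardinalPresentable (M i) κ).map (Sigma.incl i)) i
        exact h _ (ObjectProperty.prop_map_obj _ _
          (hQ.le_isCardinalPresentable _ (p.prop_diag_obj j))) }
  have := hP.hasCardinalFilteredGenerator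
  have := hasCardinalFilteredColimits_sigma (M := M) κ
  exact { }

lemma exists_isCardinalAccessible_family {D : Type u₁} [Category.{v₁} D] (F : ∀ i, M i ⥤ D)
    [∀ i, IsAccessibleCategory.{w} (M i)] [∀ i, (F i).IsAccessible.{w}] :
    ∃ (κ : Cardinal.{w}) (_ : Fact κ.IsRegular), ∀ i,
      IsCardinalAccessibleCategory (M i) κ ∧ (F i).IsCardinalAccessible κ := by
  choose ν hν using fun i ↦ exists_isCardinalAccessibleCategory.{w} (M i)
  choose ν' hν' using fun i ↦ exists_isCardinalAccessible.{w} (F i)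
  obtain ⟨κ, hκ, h⟩ := exists_powLT (Sum.elim ν ν')
  exact ⟨κ, ⟨hκ⟩, fun i ↦
    have : Fact κ.IsRegular := ⟨hκ⟩
    ⟨hν i κ (h (Sum.inl i)), hν' i κ (h (Sum.inr i))⟩⟩

/-- A small disjoint union of accessible categories is accessible, because the index of
accessibility can be raised to a common one for all summands. -/
lemma isAccessible_sigmaDesc {D : Type u₁} [Category.{v₁} D] (F : ∀ i, M i ⥤ D)
    [∀ i, IsAccessibleCategory.{w} (M i)] [∀ i, (F i).IsAccessible.{w}] :
    IsAccessibleCategory.{w} (Σ i, M i) ∧ (Sigma.desc F).IsAccessible.{w} := by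
  obtain ⟨κ, _, h⟩ := exists_isCardinalAccessible_family F
  have := fun i ↦ (h i).1
  have := fun i ↦ (h i).2
  exact ⟨⟨κ, inferInstance, isCardinalAccessibleCategory_sigma κ⟩,
    ⟨κ, inferInstance, isCardinalAccessible_of_incl κ _ fun i ↦
      Functor.isCardinalAccessible_of_natIso (Sigma.inclDesc F i).symm κ⟩⟩

end Sigma

/-! ### Composable pairs -/

section ComposablePairs

variable (K : Type u) [Category.{v} K]

variable {K} in
lemma comp_comp_of_comm {B C D B' C' D' : K} {i : B ⟶ C} {g : C ⟶ D} {i' : B' ⟶ C'}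
    {g' : C' ⟶ D'} {b : B ⟶ B'} {c : C ⟶ C'} {d : D ⟶ D'}
    (h₁ : b ≫ i' = i ≫ c) (h₂ : c ≫ g' = g ≫ d) : (i ≫ g) ≫ d = b ≫ i' ≫ g' := by
  rw [Category.assoc, ← h₂, reassoc_of% h₁]

variable {K} in
lemma inv_comp_comp_of_comm {B C D B' C' D' : K} {i : B ≅ C} {g : C ⟶ D} {i' : B' ⟶ C'}
    {g' : C' ⟶ D'} {b : B ⟶ B'} {d : D ⟶ D'} (h : (i.hom ≫ g) ≫ d = b ≫ i' ≫ g') :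
    (i.inv ≫ b ≫ i') ≫ g' = g ≫ d := by
  rw [← cancel_epi i.hom, ← Category.assoc i.hom g, h]
  simp only [Category.assoc, Iso.hom_inv_id_assoc]

/-- A composable pair as a pair of arrows together with an isomorphism of the codomain of the first
with the domain of the second. -/
def pairsToComposableArrows :
    CategoricalPullback (Arrow.rightFunc : Arrow K ⥤ K) (Arrow.leftFunc : Arrow K ⥤ K) ⥤
      ComposableArrows K 2 where
  obj x := ComposableArrows.mk₂ x.fst.hom (x.iso.hom ≫ x.snd.hom)
  map φ := ComposableArrows.homMk₂ φ.fst.left φ.fst.right φ.snd.right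
    φ.fst.w.symm (comp_comp_of_comm φ.w φ.snd.w)
  map_id _ := ComposableArrows.hom_ext₂ rfl rfl rfl
  map_comp _ _ := ComposableArrows.hom_ext₂ rfl rfl rfl

instance : (pairsToComposableArrows K).IsEquivalence where
  faithful := ⟨fun {x y φ ψ} h ↦ by
    have h₀ : φ.fst.left = ψ.fst.left := congrArg (fun t ↦ t.app 0) h
    have h₁ : φ.fst.right = ψ.fst.right := congrArg (fun t ↦ t.app 1) h
    have h₂ : φ.snd.right = ψ.snd.right := congrArg (fun t ↦ t.app 2) h
    have hφ : φ.fst.right ≫ y.iso.hom = x.iso.hom ≫ φ.snd.left := φ.w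
    have hψ : ψ.fst.right ≫ y.iso.hom = x.iso.hom ≫ ψ.snd.left := ψ.w
    have h₃ : φ.snd.left = ψ.snd.left := (cancel_epi x.iso.hom).1
      (hφ.symm.trans ((congrArg (· ≫ y.iso.hom) h₁).trans hψ))
    exact CategoricalPullback.Hom.ext (Arrow.hom_ext _ _ h₀ h₁) (Arrow.hom_ext _ _ h₃ h₂)⟩
  full := ⟨fun {x y} t ↦ by
    let a : x.fst.left ⟶ y.fst.left := t.app 0
    let b : x.fst.right ⟶ y.fst.right := t.app 1
    let c : x.snd.right ⟶ y.snd.right := t.app 2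
    have h₁ : x.fst.hom ≫ b = a ≫ y.fst.hom :=
      ComposableArrows.naturality' t 0 1
    have h₂ : (x.iso.hom ≫ x.snd.hom) ≫ c = b ≫ y.iso.hom ≫ y.snd.hom :=
      ComposableArrows.naturality' t 1 2
    let d : x.snd.left ⟶ y.snd.left := x.iso.inv ≫ b ≫ y.iso.hom
    have h₃ : d ≫ y.snd.hom = x.snd.hom ≫ c := inv_comp_comp_of_comm h₂
    have h₄ : b ≫ y.iso.hom = x.iso.hom ≫ d := (Iso.hom_inv_id_assoc x.iso (b ≫ y.iso.hom)).symm
    exact ⟨{ fst := Arrow.homMk a b h₁.symm, snd := Arrow.homMk d c h₃, w := h₄ },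
      ComposableArrows.hom_ext₂ rfl rfl rfl⟩⟩
  essSurj := ⟨fun x ↦ ⟨
    { fst := Arrow.mk (x.map' 0 1), snd := Arrow.mk (x.map' 1 2), iso := Iso.refl _ },
    ⟨ComposableArrows.isoMk₂ (Iso.refl _) (Iso.refl _) (Iso.refl _)
      ((Category.comp_id _).trans (Category.id_comp _).symm)
      ((Category.comp_id _).trans rfl)⟩⟩⟩

variable [HasColimitsOfSize.{w, w} K]

instance isAccessible_leftFunc : (Arrow.leftFunc : Arrow K ⥤ K).IsAccessible.{w} := by
  have : PreservesColimitsOfSize.{w, w} (Arrow.leftFunc : Arrow K ⥤ K) := ⟨inferInstance⟩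
  exact isAccessible_of_preservesColimits _

instance isAccessible_rightFunc : (Arrow.rightFunc : Arrow K ⥤ K).IsAccessible.{w} := by
  have : PreservesColimitsOfSize.{w, w} (Arrow.rightFunc : Arrow K ⥤ K) := ⟨inferInstance⟩
  exact isAccessible_of_preservesColimits _

lemma isAccessibleCategory_composableArrows [IsAccessibleCategory.{w} K]
    [IsAccessibleCategory.{w} (Arrow K)] : IsAccessibleCategory.{w} (ComposableArrows K 2) := by
  have := (isAccessibleCategory_categoricalPullback.{w} (Arrow.rightFunc : Arrow K ⥤ K)
    (Arrow.leftFunc : Arrow K ⥤ K)).1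
  exact (pairsToComposableArrows K).asEquivalence.isAccessibleCategory

instance isAccessible_edge (i j : Fin 3) (h : i ≤ j) : (edge K i j h).IsAccessible.{w} := by
  have (i : Fin 3) : ((evaluation (Fin 3) K).obj i).IsAccessible.{w} :=
    have : PreservesColimitsOfSize.{w, w} ((evaluation (Fin 3) K).obj i) := ⟨inferInstance⟩
    isAccessible_of_preservesColimits _
  have : (edge K i j h ⋙ Arrow.leftFunc).IsAccessible.{w} := this i
  have : (edge K i j h ⋙ Arrow.rightFunc).IsAccessible.{w} :=
    inferInstanceAs ((evaluation (Fin 3) K).obj j).IsAccessible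
  exact isAccessible_arrow _

end ComposablePairs

/-! ### Full images of accessible functors -/

section FullImages

variable {C : Type u} [Category.{v} C]

/-- The source of the functor may live in any universes, since an accessible category is equivalent
to a locally small one with a class of objects. -/
lemma isFullImageOfAccessible_essImage [IsAccessibleCategory.{w} C] {M : Type u₁}
    [Category.{v₁} M] [IsAccessibleCategory.{w} M] (F : M ⥤ C) [F.IsAccessible.{w}] :
    IsFullImageOfAccessible.{w} F.essImage := by
  obtain ⟨κ, _, _⟩ := IsAccessibleCategory.exists_cardinal.{w} M
  obtain ⟨M', _, ⟨e⟩⟩ := HasCardinalFilteredGenerator.exists_equivalence M κ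
  have := isAccessible_of_preservesColimits.{w} e.inverse
  refine ⟨inferInstance, M', inferInstance, e.inverse ⋙ F, e.isAccessibleCategory,
    inferInstance, ?_⟩
  exact le_antisymm (fun X ⟨Y, hY⟩ ↦ ⟨_, hY⟩)
    (fun X ⟨Y, ⟨i⟩⟩ ↦ ⟨e.functor.obj Y, ⟨F.mapIso (e.unitIso.app Y).symm ≪≫ i⟩⟩)

/-- A small union of full images is the full image of the functor on the disjoint union. -/
lemma IsFullImageOfAccessible.iSup {ι : Type w} [Nonempty ι] {P : ι → ObjectProperty C}
    (h : ∀ i, IsFullImageOfAccessible.{w} (P i)) : IsFullImageOfAccessible.{w} (⨆ i, P i) := by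
  have := (h (Classical.arbitrary ι)).1
  choose _ M _ F _ _ hF using h
  obtain ⟨_, _⟩ := isAccessible_sigmaDesc F
  convert isFullImageOfAccessible_essImage (Sigma.desc F)
  refine le_antisymm (iSup_le fun i ↦ ?_) ?_
  · rw [← hF i]
    rintro X ⟨Y, ⟨e⟩⟩
    exact ⟨⟨i, Y⟩, ⟨e⟩⟩
  · rintro X ⟨⟨i, Y⟩, ⟨e⟩⟩
    refine le_iSup P i X ?_
    rw [← hF i]
    exact ⟨Y, ⟨e⟩⟩

lemma IsFullImageOfAccessible.iSup_nat {P : ℕ → ObjectProperty C}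
    (h : ∀ n, IsFullImageOfAccessible.{w} (P n)) : IsFullImageOfAccessible.{w} (⨆ n, P n) := by
  rw [← Equiv.ulift.{w}.iSup_comp (g := P)]
  exact .iSup fun _ ↦ h _

lemma IsFullImageOfAccessible.sup {P Q : ObjectProperty C}
    (hP : IsFullImageOfAccessible.{w} P) (hQ : IsFullImageOfAccessible.{w} Q) :
    IsFullImageOfAccessible.{w} (P ⊔ Q) := by
  rw [sup_eq_iSup, ← Equiv.ulift.{w}.iSup_comp]
  exact .iSup fun ⟨b⟩ ↦ by cases b <;> assumption

end FullImages

section Stages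

variable {K : Type u} [Category.{v} K] {X : MorphismProperty K}

/-- If `X` is the full image of `F : M ⥤ K^→`, then `X × X` may be replaced by `M × M` in the
pseudopullback without changing the full image. -/
lemma IsFullImageOfAccessible.pairsImage
    (hX : IsFullImageOfAccessible.{w} (arrows X)) (p q r : ComposableArrows K 2 ⥤ Arrow K)
    [IsAccessibleCategory.{w} (ComposableArrows K 2)]
    [p.IsAccessible.{w}] [q.IsAccessible.{w}] [r.IsAccessible.{w}] :
    IsFullImageOfAccessible.{w} (arrows (pairsImage X p q r)) := by
  obtain ⟨_, M, _, F, _, _, hF⟩ := hX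
  have := isAccessible_prodFst M M
  have := isAccessible_prodSnd M M
  have := isAccessibleCategory_prod M M
  have := isAccessibleCategory_prod (Arrow K) (Arrow K)
  have := isAccessible_prod' (CategoryTheory.Prod.fst M M ⋙ F) (CategoryTheory.Prod.snd M M ⋙ F)
  have := isAccessible_prod' p q
  let G := (CategoryTheory.Prod.fst M M ⋙ F).prod' (CategoryTheory.Prod.snd M M ⋙ F)
  obtain ⟨_, _, _⟩ := isAccessibleCategory_categoricalPullback.{w} G (p.prod' q)
  have := isFullImageOfAccessible_essImage.{w} (CategoricalPullback.π₂ G (p.prod' q) ⋙ r)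
  convert this using 1
  have hF' (f : Arrow K) : F.essImage f ↔ X f.hom := by rw [hF]; rfl
  refine le_antisymm ?_ ?_
  · rintro f ⟨x, ⟨e⟩⟩
    obtain ⟨a, ⟨ea⟩⟩ := (hF' x.fst.1.obj).2 x.fst.1.property
    obtain ⟨b, ⟨eb⟩⟩ := (hF' x.fst.2.obj).2 x.fst.2.property
    exact ⟨{ fst := (a, b), snd := x.snd, iso := Iso.prod ea eb ≪≫ x.iso }, ⟨e⟩⟩
  · rintro f ⟨x, ⟨e⟩⟩
    exact ⟨{ fst := (⟨F.obj x.fst.1, (hF' _).1 (F.obj_mem_essImage _)⟩,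
        ⟨F.obj x.fst.2, (hF' _).1 (F.obj_mem_essImage _)⟩), snd := x.snd, iso := x.iso }, ⟨e⟩⟩

lemma isFullImageOfAccessible_stage [IsLocallyPresentable.{w} K]
    (hX : IsFullImageOfAccessible.{w} (arrows X)) (n : ℕ) :
    IsFullImageOfAccessible.{w} (arrows (stage X n)) := by
  have := hX.1
  obtain ⟨κ, _, _⟩ := IsLocallyPresentable.exists_cardinal.{w} K
  have := isAccessibleCategory_composableArrows.{w} K
  induction n with
  | zero => exact hX
  | succ n ih =>
    have h₀ := ih.pairsImage (first K) (second K) (composite K)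
    have h₁ := ih.pairsImage (first K) (composite K) (second K)
    have h₂ := ih.pairsImage (second K) (composite K) (first K)
    rw [stage]
    split_ifs
    exacts [ih.sup h₀, ih.sup h₁, ih.sup h₂]

end Stages

/-! ### Stages of the 2-out-of-3 closure -/

section Closure

variable {K : Type u} [Category.{v} K]

lemma pairsImage_iff (X : MorphismProperty K) (p q r : ComposableArrows K 2 ⥤ Arrow K) {A B : K}
    (h : A ⟶ B) : pairsImage X p q r h ↔ ∃ Z : ComposableArrows K 2,
      (arrows X).isoClosure (p.obj Z) ∧ (arrows X).isoClosure (q.obj Z) ∧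
        Nonempty (r.obj Z ≅ Arrow.mk h) := by
  constructor
  · rintro ⟨x, ⟨e⟩⟩
    have e₁ : x.fst.1.obj ≅ p.obj x.snd := (CategoryTheory.Prod.fst _ _).mapIso x.iso
    have e₂ : x.fst.2.obj ≅ q.obj x.snd := (CategoryTheory.Prod.snd _ _).mapIso x.iso
    exact ⟨x.snd, ⟨x.fst.1.obj, x.fst.1.property, ⟨e₁.symm⟩⟩,
      ⟨x.fst.2.obj, x.fst.2.property, ⟨e₂.symm⟩⟩, ⟨e⟩⟩
  · rintro ⟨Z, ⟨a, ha, ⟨e₁⟩⟩, ⟨b, hb, ⟨e₂⟩⟩, ⟨e⟩⟩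
    exact ⟨{ fst := (⟨a, ha⟩, ⟨b, hb⟩), snd := Z, iso := Iso.prod e₁.symm e₂.symm }, ⟨e⟩⟩

instance (X : MorphismProperty K) (p q r : ComposableArrows K 2 ⥤ Arrow K) :
    (pairsImage X p q r).RespectsIso :=
  MorphismProperty.RespectsIso.of_respects_arrow_iso _ fun f g e hf ↦ by
    rw [pairsImage_iff] at hf ⊢
    obtain ⟨Z, h₁, h₂, ⟨e'⟩⟩ := hf
    exact ⟨Z, h₁, h₂, ⟨e' ≪≫ e⟩⟩

lemma monotone_stage (X : MorphismProperty K) : Monotone (stage X) :=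
  monotone_nat_of_le_succ fun n ↦ by
    rw [stage]
    exact le_sup_left

variable {X : MorphismProperty K}

instance [X.RespectsIso] : (arrows X).IsClosedUnderIsomorphisms where
  of_iso e h := (X.arrow_mk_iso_iff e).1 h

variable [X.RespectsIso]

lemma composites_iff {A C : K} (h : A ⟶ C) :
    composites X h ↔ ∃ (B : K) (f : A ⟶ B) (g : B ⟶ C), X f ∧ X g ∧ f ≫ g = h := by
  refine (pairsImage_iff ..).trans ?_
  simp only [ObjectProperty.isoClosure_eq_self]
  constructor
  · rintro ⟨Z, hf, hg, ⟨e⟩⟩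
    obtain ⟨A', B, C', f, g, rfl⟩ := ComposableArrows.mk₂_surjective Z
    let a : A ≅ A' := Arrow.leftFunc.mapIso e.symm
    let c : C' ≅ C := Arrow.rightFunc.mapIso e
    have w : a.hom ≫ f ≫ g = h ≫ c.inv := e.inv.w
    refine ⟨B, a.hom ≫ f, g ≫ c.hom, (X.cancel_left_of_respectsIso a.hom f).2 hf,
      (X.cancel_right_of_respectsIso g c.hom).2 hg, ?_⟩
    rw [Category.assoc, ← Category.assoc f, ← Category.assoc, w, Category.assoc,
      Iso.inv_hom_id, Category.comp_id]
  · rintro ⟨B, f, g, hf, hg, rfl⟩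
    exact ⟨ComposableArrows.mk₂ f g, hf, hg, ⟨Iso.refl _⟩⟩

lemma leftFactors_iff {B C : K} (g : B ⟶ C) :
    leftFactors X g ↔ ∃ (A : K) (f : A ⟶ B), X f ∧ X (f ≫ g) := by
  refine (pairsImage_iff ..).trans ?_
  simp only [ObjectProperty.isoClosure_eq_self]
  constructor
  · rintro ⟨Z, hf, hfg, ⟨e⟩⟩
    obtain ⟨A, B', C', f, g', rfl⟩ := ComposableArrows.mk₂_surjective Z
    let b : B' ≅ B := Arrow.leftFunc.mapIso e
    let c : C' ≅ C := Arrow.rightFunc.mapIso e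
    have w : b.hom ≫ g = g' ≫ c.hom := e.hom.w
    refine ⟨A, f ≫ b.hom, (X.cancel_right_of_respectsIso f b.hom).2 hf, ?_⟩
    rw [Category.assoc, w, ← Category.assoc]
    exact (X.cancel_right_of_respectsIso (f ≫ g') c.hom).2 hfg
  · rintro ⟨A, f, hf, hfg⟩
    exact ⟨ComposableArrows.mk₂ f g, hf, hfg, ⟨Iso.refl _⟩⟩

lemma rightFactors_iff {A B : K} (f : A ⟶ B) :
    rightFactors X f ↔ ∃ (C : K) (g : B ⟶ C), X g ∧ X (f ≫ g) := by
  refine (pairsImage_iff ..).trans ?_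
  simp only [ObjectProperty.isoClosure_eq_self]
  constructor
  · rintro ⟨Z, hg, hfg, ⟨e⟩⟩
    obtain ⟨A', B', C, f', g, rfl⟩ := ComposableArrows.mk₂_surjective Z
    let a : A ≅ A' := Arrow.leftFunc.mapIso e.symm
    let b : B ≅ B' := Arrow.rightFunc.mapIso e.symm
    have w : a.hom ≫ f' = f ≫ b.hom := e.inv.w
    refine ⟨C, b.hom ≫ g, (X.cancel_left_of_respectsIso b.hom g).2 hg, ?_⟩
    rw [← Category.assoc, ← w, Category.assoc]
    exact (X.cancel_left_of_respectsIso a.hom (f' ≫ g)).2 hfg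
  · rintro ⟨C, g, hg, hfg⟩
    exact ⟨ComposableArrows.mk₂ f g, hg, hfg, ⟨Iso.refl _⟩⟩

instance respectsIso_stage (n : ℕ) : (stage X n).RespectsIso := by
  have sup (P Q : MorphismProperty K) [P.RespectsIso] [Q.RespectsIso] : (P ⊔ Q).RespectsIso :=
    MorphismProperty.RespectsIso.of_respects_arrow_iso _ fun f g e hf ↦
      hf.imp (P.arrow_mk_iso_iff e).1 (Q.arrow_mk_iso_iff e).1
  induction n with
  | zero => assumption
  | succ n ih =>
    unfold stage
    split_ifs
    · exact sup _ (pairsImage ..)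
    · exact sup _ (pairsImage ..)
    · exact sup _ (pairsImage ..)

variable (X) in
lemma hasTwoOutOfThreeProperty_iSup_stage :
    (⨆ n, stage X n).HasTwoOutOfThreeProperty := by
  -- Two members of the union lie in a common stage whose index has any prescribed residue.
  have key (r : ℕ) (hr : r < 3) {A B C D : K} (f : A ⟶ B) (g : C ⟶ D)
      (hf : (⨆ n, stage X n) f) (hg : (⨆ n, stage X n) g) :
      ∃ n, n % 3 = r ∧ stage X n f ∧ stage X n g := by
    rw [MorphismProperty.iSup_iff] at hf hg
    obtain ⟨i, hi⟩ := hf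
    obtain ⟨j, hj⟩ := hg
    exact ⟨3 * (i + j) + r, by omega, monotone_stage X (by omega) _ hi,
      monotone_stage X (by omega) _ hj⟩
  have mem {n : ℕ} {A B : K} {f : A ⟶ B} (hf : stage X n f) : (⨆ n, stage X n) f :=
    le_iSup (stage X) n _ hf
  refine {
    comp_mem := fun f g hf hg ↦ ?_,
    of_postcomp := fun f g hg hfg ↦ ?_, of_precomp := fun f g hf hfg ↦ ?_ }
  · obtain ⟨n, hn, hf, hg⟩ := key 0 (by decide) f g hf hg
    refine mem (n := n + 1) ?_
    rw [stage, if_pos hn]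
    exact Or.inr ((composites_iff _).2 ⟨_, f, g, hf, hg, rfl⟩)
  · obtain ⟨n, hn, hg, hfg⟩ := key 2 (by decide) g (f ≫ g) hg hfg
    refine mem (n := n + 1) ?_
    rw [stage, if_neg (by omega), if_neg (by omega)]
    exact Or.inr ((rightFactors_iff _).2 ⟨_, g, hg, hfg⟩)
  · obtain ⟨n, hn, hf, hfg⟩ := key 1 (by decide) f (f ≫ g) hf hfg
    refine mem (n := n + 1) ?_
    rw [stage, if_neg (by omega), if_pos hn]
    exact Or.inr ((leftFactors_iff _).2 ⟨_, f, hf, hfg⟩)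

/-- It is not assumed that `W` respects isomorphisms: since the stages do, an isomorphism in the
definition of `pairsImage` can be absorbed into the members of the composable pair. -/
lemma stage_le {W : MorphismProperty K} [W.HasTwoOutOfThreeProperty] (h : X ≤ W) (n : ℕ) :
    stage X n ≤ W := by
  induction n with
  | zero => exact h
  | succ n ih =>
    refine sup_le ih fun A B f hf ↦ ?_
    split_ifs at hf
    · obtain ⟨_, f, g, hf', hg, rfl⟩ := (composites_iff _).1 hf
      exact W.comp_mem f g (ih _ hf') (ih _ hg)
    · obtain ⟨_, g, hg, hgf⟩ := (leftFactors_iff _).1 hf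
      exact W.of_precomp g f (ih _ hg) (ih _ hgf)
    · obtain ⟨_, g, hg, hgf⟩ := (rightFactors_iff _).1 hf
      exact W.of_postcomp f g (ih _ hg) (ih _ hgf)

variable (X) in
theorem twoOutOfThreeClosure_eq_iSup_stage :
    twoOutOfThreeClosure X = ⨆ n, stage X n :=
  le_antisymm (twoOutOfThreeClosure_le (le_iSup (stage X) 0)
      (hasTwoOutOfThreeProperty_iSup_stage X))
    (iSup_le fun n ↦
      have := hasTwoOutOfThreeProperty_twoOutOfThreeClosure X
      stage_le (le_twoOutOfThreeClosure X) n)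

end Closure

end FullImage

theorem mainTheorem5 {K : Type u} [Category.{v} K] [IsLocallyPresentable.{w} K]
    (X : MorphismProperty K)
    (hX : FullImage.IsFullImageOfAccessible.{w} (FullImage.arrows X)) :
    FullImage.IsFullImageOfAccessible.{w} (FullImage.arrows (FullImage.twoOutOfThreeClosure X)) ∧
      (∀ n : ℕ, FullImage.IsFullImageOfAccessible.{w} (FullImage.arrows (FullImage.stage X n))) ∧
      FullImage.twoOutOfThreeClosure X = ⨆ n : ℕ, FullImage.stage X n := by
  have h (n : ℕ) := FullImage.isFullImageOfAccessible_stage hX n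
  -- A full image is closed under isomorphisms.
  have : X.RespectsIso := by
    obtain ⟨_, M, _, F, _, _, hF⟩ := hX
    have hF' (f : Arrow K) : F.essImage f ↔ X f.hom := by rw [hF]; rfl
    exact .of_respects_arrow_iso _ fun f g e hf ↦
      (hF' g).1 (Functor.essImage.ofIso e ((hF' f).2 hf))
  have h' := FullImage.twoOutOfThreeClosure_eq_iSup_stage X
  refine ⟨?_, h, h'⟩
  convert FullImage.IsFullImageOfAccessible.iSup_nat h using 1
  ext f
  simp [FullImage.arrows, h', MorphismProperty.iSup_iff]
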